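/- Let $N,L\ge 1$, $n\in\mathbb Z$, and write $\doteq$ for equality up to a phase in $U(1)$. **Setting.** On a periodic chain of $L$ sites with local space $\mathbb C^d$, a $\mathbb Z_N$ *charge and dipole symmetry* consists of on-site unitaries $U_{q,j},U_{d,j}$ ($j\in\mathbb Z$), $L$-periodic in $j$, with $U_{q,j}^N\doteq 1$, $U_{d,j}^N\doteq 1$, and, with $\mathcal T$ the one-site translation, $\mathcal T U_{q,j}\mathcal T^\dagger=U_{q,j-1}$, $\mathcal T U_{d,j}\mathcal T^\dagger=U_{d,j-1}U_{q,j-1}$; that is, as $d\times d$ matrices, $U_{q,j}=U_{q,j-1}$ and $U_{d,j}=U_{d,j-1}U_{q,j-1}$. The on-site operators are said to *commute up to $e^{2\pi i n/N}$* if $$U_{q,j}U_{d,j}=e^{2\pi i n/N}\,U_{d,j}U_{q,j}\quad\text{for all } j.$$ An MPS tensor $A=(A^s)_{s=1}^d$ of $\chi\times\chi$ matrices gives the states $|\psi_M\rangle=\sum_{s_1,\dots,s_M}\mathrm{Tr}(A^{s_1}\cdots A^{s_M})|s_1\cdots s_M\rangle$. It is *injective* if its transfer matrix $X\mapsto\sum_s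 A^sX(A^s)^\dagger$ has a unique dominant eigenvalue $r>0$ (every eigenvalue $\mu$ with $|\mu|\ge r$ equals $r$), with one-dimensional eigenspace, and the corresponding right and left eigenvectors can be chosen positive definite; it is *left-canonical* if $\sum_s (A^s)^\dagger A^s=1$. It is *symmetric* under $L$-periodic on-site unitaries $U_j$ if $\bigotimes_{j=1}^{kL}U_j|\psi_{kL}\rangle\doteq|\psi_{kL}\rangle$ for every $k\ge1$. Put $(U\cdot A)^s=\sum_t U_{st}A^t$. **Claims.** 1. (Push-through.) If $A$ is injective, left-canonical and symmetric under both $U_q$ and $U_d$ of a $\mathbb Z_N$ charge and dipole symmetry, then there are unitary $\chi\times\chi$ matrices $v_q$ and $v_{d,j}$ ($j\in\mathbb Z$) with $U_{q,j}\cdot A\doteq v_q^\dagger A v_q$, $U_{d,j}\cdot A\doteq v_{d,j-1}^\dagger A v_{d,j}$ and $v_{d,j+L}\doteq v_{d,j}$ for all $j$. 2. (Site-independence.) For every $\mathbb Z_N$ charge and dipole symmetry, every injective $A$ and all unitaries $v_q,v_{d,j}$ satisfying the two push-through relations of 1 for all $j$, one has $v_{d,j}\doteq v_{d,j-1}v_q$,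 and the commutator $v_qv_{d,j}v_q^{-1}v_{d,j}^{-1}$ does not depend on $j$. 3. (Required change.) Let $U_{q,j},U_{d,j}$ be on-site unitaries with $U_{q,j}^N\doteq1\doteq U_{d,j}^N$ that commute up to $e^{2\pi i n/N}$, and let $A$ be injective and $v_q,v_{d,j}$ unitaries satisfying the two push-through relations of 1 for all $j$. Then there are integers $k_j$ with $v_qv_{d,j}v_q^{-1}v_{d,j}^{-1}=e^{2\pi i k_j/N}\,1$ and $k_j\equiv k_{j-1}+n\pmod N$ for all $j$. (The phase labels the projective class on the bond $j$.) 4. (LSM constraint.) If a $\mathbb Z_N$ charge and dipole symmetry commutes on site up to $e^{2\pi i n/N}$ and $n\not\equiv0\pmod N$, then no injective MPS tensor, of any bond dimension, is symmetric under both $U_q$ and $U_d$. 5. (Example.) Let $N\mid L$, $d=N$, $X|s\rangle=|s+1 \bmod N\rangle$ and $Z|s\rangle=e^{2\pi i s/N}|s\rangle$. Then $U_{q,j}=X$, $U_{d,j}=Z^{-n}X^j$ form a $\mathbb Z_N$ charge and dipole symmetry that commutes on site up to $e^{2\pi i n/N}$; so for $n\not\equiv 0\pmod N$ there is no injective MPS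 tensor symmetric under both $\mathcal U_q=\bigotimes_jX_j$ and $\mathcal U_d=\bigotimes_jZ_j^{-n}X_j^j$. -/

import Mathlib

namespace DipoleLSM

noncomputable section

open Matrix Complex
open scoped ComplexOrder

/-- Equality up to a phase (written `≐` in physics): `x = z y` for some complex `z` with
`|z| = 1`. -/
def EqPhase {M : Type*} [SMul ℂ M] (x y : M) : Prop :=
  ∃ z : ℂ, ‖z‖ = 1 ∧ x = z • y

/-- A translation invariant MPS tensor with physical dimension `d` and bond dimension `χ`:
one `χ × χ` matrix `A s` for each physical index `s`. -/
abbrev Tensor (d χ : ℕ) := Fin d → Matrix (Fin χ) (Fin χ) ℂ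

/-- Unitary operators on a `d`-dimensional space. -/
abbrev Unitary (d : ℕ) := Matrix.unitaryGroup (Fin d) ℂ

/-- The transfer matrix `∑ₛ Aˢ ⊗ (Aˢ)*`, acting on bond matrices (right action):
`X ↦ ∑ₛ Aˢ X (Aˢ)†`. -/
def transfer {d χ : ℕ} (A : Tensor d χ) : Module.End ℂ (Matrix (Fin χ) (Fin χ) ℂ) where
  toFun X := ∑ s, A s * X * (A s)ᴴ
  map_add' X Y := by simp only [Matrix.mul_add, Matrix.add_mul, Finset.sum_add_distrib]
  map_smul' c X := by
    simp only [Matrix.mul_smul, Matrix.smul_mul, Finset.smul_sum, RingHom.id_apply]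

/-- The transfer matrix acting from the other side: `X ↦ ∑ₛ (Aˢ)† X Aˢ`. -/
def transferLeft {d χ : ℕ} (A : Tensor d χ) : Module.End ℂ (Matrix (Fin χ) (Fin χ) ℂ) :=
  transfer fun s => (A s)ᴴ

/-- An injective MPS tensor: the transfer matrix has a unique dominant eigenvalue `r > 0`, which
is nondegenerate, and the dominant right and left eigenvectors are positive definite.
(Eigenvectors are nonzero, so the bond dimension is positive.) No choice of gauge or of
normalization is made here. -/
def IsInjective {d χ : ℕ} (A : Tensor d χ) : Prop :=
  ∃ (r : ℝ) (ρ Λ : Matrix (Fin χ) (Fin χ) ℂ), 0 < r ∧ ρ.PosDef ∧ Λ.PosDef ∧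
    (transfer A).HasEigenvector (r : ℂ) ρ ∧
    (transferLeft A).HasEigenvector (r : ℂ) Λ ∧
    ∀ (μ : ℂ) (X : Matrix (Fin χ) (Fin χ) ℂ), (transfer A).HasEigenvector μ X → r ≤ ‖μ‖ →
      μ = (r : ℂ) ∧ ∃ c : ℂ, X = c • ρ

/-- Left-canonical gauge: `∑ₛ (Aˢ)† Aˢ = 1`. For an injective tensor the dominant eigenvalue of
the transfer matrix is then `1`, with left eigenvector the identity. -/
def IsLeftCanonical {d χ : ℕ} (A : Tensor d χ) : Prop :=
  ∑ s, (A s)ᴴ * A s = 1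

/-- The periodic MPS on `M` sites: the vector with the components `Tr (A^{s₁} ⋯ A^{s_M})`. -/
def state {d χ : ℕ} (A : Tensor d χ) (M : ℕ) : (Fin M → Fin d) → ℂ :=
  fun s => (List.ofFn fun i => A (s i)).prod.trace

/-- The operator `⨂_{j=1}^M U_j` on `M` sites. The position `i = 0, …, M - 1` carries the
site label `j = i + 1`. -/
def globalOp {d : ℕ} (U : ℤ → Unitary d) (M : ℕ) :
    Matrix (Fin M → Fin d) (Fin M → Fin d) ℂ :=
  Matrix.of fun s t => ∏ i : Fin M, (U ((i : ℤ) + 1) : Matrix (Fin d) (Fin d) ℂ) (s i) (t i)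

/-- The MPS is symmetric under the on-site operators `U_j` (`L`-periodic in `j`): for each
`k ≥ 1`, on the chain made of `k` copies of the `L`-site unit cell the state is invariant up to
a phase under `⨂_{j=1}^{kL} U_j`, the `k`-fold periodic extension of `⨂_{j=1}^L U_j`. -/
def IsSymmetric {d χ : ℕ} (L : ℕ) (U : ℤ → Unitary d) (A : Tensor d χ) : Prop :=
  ∀ k : ℕ, 0 < k → EqPhase (globalOp U (k * L) *ᵥ state A (k * L)) (state A (k * L))

/-- Action of an operator on the physical leg: `(U · A)ˢ = ∑ₜ U_{st} Aᵗ`. -/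
def act {d χ : ℕ} (U : Unitary d) (A : Tensor d χ) : Tensor d χ :=
  fun s => ∑ t, (U : Matrix (Fin d) (Fin d) ℂ) s t • A t

/-- The push-through condition `U_j · A ≐ v_{j-1}† A v_j` at all sites `j`, where `v_j` is a
unitary on the bond between the sites `j` and `j + 1`. -/
def PushesThrough {d χ : ℕ} (A : Tensor d χ) (U : ℤ → Unitary d) (v : ℤ → Unitary χ) : Prop :=
  ∀ j : ℤ, EqPhase (act (U j) A)
    (fun s => (v (j - 1) : Matrix (Fin χ) (Fin χ) ℂ)ᴴ * A s * (v j : Matrix (Fin χ) (Fin χ) ℂ))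

/-- The commutator `v_q v_d v_q⁻¹ v_d⁻¹` of two bond unitaries. When it is a phase, it is the
coboundary-invariant phase `ω(q,d) ω(d,q)⁻¹` that labels the projective class on the bond. -/
def bondInvariant {χ : ℕ} (vq vd : Unitary χ) : Unitary χ :=
  vq * vd * vq⁻¹ * vd⁻¹

/-- On each site the operators generate a (possibly projective) representation of `ℤ_N`:
`U_j ^ N` is a phase. -/
def IsZN {d : ℕ} (N : ℕ) (U : ℤ → Unitary d) : Prop :=
  ∀ j : ℤ, EqPhase ((U j : Matrix (Fin d) (Fin d) ℂ) ^ N) 1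

/-- A `ℤ_N` charge and dipole symmetry on the periodic chain of `L` sites, with on-site charge
operators `U_{q,j}` and on-site dipole operators `U_{d,j}`. Conjugation by the one-site translation
carries an operator on the site `j` to the same matrix on the site `j - 1`, so that
`T U_{q,j} T† = U_{q,j-1}` and `T U_{d,j} T† = U_{d,j-1} U_{q,j-1}` read as below. -/
structure IsDipoleSymmetry {d : ℕ} (N L : ℕ) (Uq Ud : ℤ → Unitary d) : Prop where
  periodic_q : Function.Periodic Uq (L : ℤ)
  periodic_d : Function.Periodic Ud (L : ℤ)
  zn_q : IsZN N Uq
  zn_d : IsZN N Ud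
  translate_q : ∀ j : ℤ, Uq j = Uq (j - 1)
  translate_d : ∀ j : ℤ, Ud j = Ud (j - 1) * Uq (j - 1)

/-- The phase `exp (2 π i k / N)`. -/
def rootPhase (N : ℕ) (k : ℤ) : ℂ := Complex.exp (2 * Real.pi * Complex.I * k / N)

/-- On-site projective relation `U_{q,j} U_{d,j} = exp (2 π i n / N) U_{d,j} U_{q,j}`. -/
def OnSiteProjective {d : ℕ} (N : ℕ) (n : ℤ) (Uq Ud : ℤ → Unitary d) : Prop :=
  ∀ j : ℤ, (Uq j : Matrix (Fin d) (Fin d) ℂ) * (Ud j : Matrix (Fin d) (Fin d) ℂ) =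
    rootPhase N n • ((Ud j : Matrix (Fin d) (Fin d) ℂ) * (Uq j : Matrix (Fin d) (Fin d) ℂ))

/-- There is an injective MPS, of some bond dimension, that is symmetric under both the charge
and the dipole symmetry. -/
def HasSymmetricInjectiveMPS {d : ℕ} (L : ℕ) (Uq Ud : ℤ → Unitary d) : Prop :=
  ∃ (χ : ℕ) (A : Tensor d χ), IsInjective A ∧ IsSymmetric L Uq A ∧ IsSymmetric L Ud A

/-- The shift operator `X |s⟩ = |s + 1⟩` of an `N`-dimensional qudit (addition modulo `N`). -/
def shift (N : ℕ) [NeZero N] : Unitary N :=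
  ⟨Matrix.of fun s t => if s = t + 1 then 1 else 0, by
    rw [Matrix.mem_unitaryGroup_iff']
    ext s t
    simp [Matrix.mul_apply, Matrix.one_apply, Matrix.star_apply, apply_ite, eq_comm]⟩

/-- The clock operator `Z |s⟩ = exp (2 π i s / N) |s⟩` of an `N`-dimensional qudit. -/
def clock (N : ℕ) : Unitary N :=
  ⟨Matrix.diagonal fun s => rootPhase N (s : ℤ), by
    rw [Matrix.mem_unitaryGroup_iff', Matrix.star_eq_conjTranspose,
      Matrix.diagonal_conjTranspose, Matrix.diagonal_mul_diagonal, ← Matrix.diagonal_one]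
    congr 1
    funext s
    have h : ‖rootPhase N (s : ℤ)‖ = 1 := by
      have e : rootPhase N (s : ℤ) = Complex.exp (((2 * Real.pi * (s : ℕ) / N : ℝ) : ℂ) * I) := by
        unfold rootPhase
        congr 1
        push_cast
        ring
      rw [e, Complex.norm_exp_ofReal_mul_I]
    simp only [Pi.star_apply, RCLike.star_def]
    rw [mul_comm, Complex.mul_conj, Complex.normSq_eq_norm_sq, h]
    simp⟩

end

end DipoleLSM

/-!
For an injective tensor the powers of the normalized transfer matrix converge to the rank-one
projection onto its positive definite fixed point. If the state on `k L` sites is preserved up to a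
phase, the trace of the ordered product of the mixed transfer matrices of `U_j · A` and `A` has the
modulus of `Tr (T ^ (k L))` and does not tend to zero. Hence the cyclic shift twisted by these
matrices has an eigenvector of modulus at least one. The mixed transfer matrices are contractions
for the inner product weighted by the fixed point, so equality holds throughout and the eigenvector
consists of intertwiners `(U_j · A) y_j ∝ y_{j-1} A`. Their Gram matrices are permuted by the left
transfer matrix, hence are multiples of `1`, and the `y_j` are unitaries up to a common factor.

Bond unitaries are unique up to phases by the same spectral gap, because an intertwiner of `A` with
itself gives a bounded orbit of the transfer matrix running backwards for ever. Uniqueness turns the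
relations between the on-site operators into relations between the bond unitaries up to phases:
`U_{d,j} = U_{d,j-1} U_{q,j-1}` gives `v_{d,j} ≐ v_{d,j-1} v_q`, so that the commutator of `v_q` and
`v_{d,j}` does not depend on `j`, while comparing the two orders of `U_q U_d` shows that it
changes by `exp (2 π i n / N)` from each bond to the next. The two conclusions are compatible only
if `N ∣ n`.
-/

namespace DipoleLSM

open Filter Topology
open scoped Matrix ComplexOrder

section SpectralGap

theorem tendsto_pow_zero_of_forall_spectrum_norm_lt_one {B : Type*} [NormedRing B]
    [NormedAlgebra ℂ B] [CompleteSpace B] {a : B} (h : ∀ μ ∈ spectrum ℂ a, ‖μ‖ < 1) :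
    Tendsto (fun k : ℕ => a ^ k) atTop (𝓝 0) := by
  have hr : spectralRadius ℂ a < 1 := by
    rcases subsingleton_or_nontrivial B with hB | hB
    · simp [spectrum.SpectralRadius.of_subsingleton]
    · exact spectrum.spectralRadius_lt_of_forall_lt (r := 1) a fun μ hμ => mod_cast h μ hμ
  obtain ⟨q, hq, hq1⟩ := ENNReal.lt_iff_exists_nnreal_btwn.1 hr
  have hroot :=
    (spectrum.pow_nnnorm_pow_one_div_tendsto_nhds_spectralRadius a).eventually_lt_const hq
  refine squeeze_zero_norm' ?_ (tendsto_pow_atTop_nhds_zero_of_lt_one q.2 (mod_cast hq1))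
  filter_upwards [hroot, eventually_gt_atTop 0] with k hk hk0
  have hle : (‖a ^ k‖₊ : ENNReal) ≤ q ^ k := by
    rw [← ENNReal.rpow_natCast, ← ENNReal.rpow_one (‖a ^ k‖₊ : ENNReal),
      ← one_div_mul_cancel (Nat.cast_ne_zero.2 hk0.ne' : (k : ℝ) ≠ 0), ENNReal.rpow_mul]
    exact ENNReal.rpow_le_rpow hk.le k.cast_nonneg
  exact_mod_cast hle

theorem sub_pow_succ_of_mul_eq {R : Type*} [Ring R] {a p : R} (hap : a * p = p)
    (hpa : p * a = p) (hpp : p * p = p) (k : ℕ) : (a - p) ^ (k + 1) = a ^ (k + 1) - p := by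
  have hakp : ∀ k, a ^ k * p = p := fun k => by
    induction k with
    | zero => rw [pow_zero, one_mul]
    | succ k ih => rw [pow_succ, mul_assoc, hap, ih]
  induction k with
  | zero => rw [zero_add, pow_one, pow_one]
  | succ k ih =>
    rw [pow_succ, ih, sub_mul, mul_sub, mul_sub, ← pow_succ, hakp, hpa, hpp, sub_self, sub_zero]

variable {V : Type*} [NormedAddCommGroup V] [NormedSpace ℂ V] [FiniteDimensional ℂ V]
  {f : Module.End ℂ V}

theorem tendsto_end_pow_zero (h : ∀ μ, f.HasEigenvalue μ → ‖μ‖ < 1) :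
    Tendsto (fun k : ℕ => Module.End.toContinuousLinearMap V (f ^ k)) atTop (𝓝 0) := by
  have : CompleteSpace V := FiniteDimensional.complete ℂ V
  simp only [map_pow]
  refine tendsto_pow_zero_of_forall_spectrum_norm_lt_one fun μ hμ => h μ ?_
  rwa [AlgEquiv.spectrum_eq, ← Module.End.hasEigenvalue_iff_mem_spectrum] at hμ

theorem tendsto_linearMap_end {F : ℕ → Module.End ℂ V} {g : Module.End ℂ V}
    (h : Tendsto (fun k => Module.End.toContinuousLinearMap V (F k)) atTop
      (𝓝 (Module.End.toContinuousLinearMap V g))) (φ : Module.End ℂ V →ₗ[ℂ] ℂ) :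
    Tendsto (fun k => φ (F k)) atTop (𝓝 (φ g)) := by
  let e := Module.End.toContinuousLinearMap (𝕜 := ℂ) V
  have hφ : Continuous (φ ∘ₗ e.symm.toLinearMap) := LinearMap.continuous_of_finiteDimensional _
  simpa [e, Function.comp_def] using (hφ.tendsto (e g)).comp h

end SpectralGap

/-- The endomorphism `f` fixes the vector `ρ` and the functional `ℓ`, normalized by `ℓ ρ = 1`, and
all its other eigenvalues lie in the open unit disc. Then `x ↦ ℓ x • ρ` is the limit of the powers
of `f`. -/
structure IsDominantPair {V : Type*} [AddCommGroup V] [Module ℂ V] (f : Module.End ℂ V) (ρ : V)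
    (ℓ : Module.Dual ℂ V) : Prop where
  map_vector : f ρ = ρ
  comp_functional : ℓ ∘ₗ f = ℓ
  pairing : ℓ ρ = 1
  gap : ∀ (μ : ℂ) (x : V), f x = μ • x → 1 ≤ ‖μ‖ → ∃ c : ℂ, x = c • ρ

namespace IsDominantPair

section Algebraic

variable {V : Type*} [AddCommGroup V] [Module ℂ V] {f : Module.End ℂ V} {ρ : V}
  {ℓ : Module.Dual ℂ V}

theorem of_eigenvectors {r : ℂ} (hr : r ≠ 0) (hρ : f ρ = r • ρ) (hℓ : ℓ ∘ₗ f = r • ℓ)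
    (hℓρ : ℓ ρ ≠ 0) (gap : ∀ (μ : ℂ) (x : V), f x = μ • x → ‖r‖ ≤ ‖μ‖ → ∃ c : ℂ, x = c • ρ) :
    IsDominantPair (r⁻¹ • f) ρ ((ℓ ρ)⁻¹ • ℓ) where
  map_vector := by rw [LinearMap.smul_apply, hρ, inv_smul_smul₀ hr]
  comp_functional := by
    rw [LinearMap.comp_smul, LinearMap.smul_comp, hℓ, smul_comm, inv_smul_smul₀ hr]
  pairing := inv_mul_cancel₀ hℓρ
  gap μ x hx hμ := by
    rw [LinearMap.smul_apply, inv_smul_eq_iff₀ hr, smul_smul] at hx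
    exact gap _ x hx (by rw [norm_mul]; exact le_mul_of_one_le_right (norm_nonneg r) hμ)

theorem norm_eigenvalue_sub_lt_one (h : IsDominantPair f ρ ℓ) {μ : ℂ}
    (hμ : (f - ℓ.smulRight ρ).HasEigenvalue μ) : ‖μ‖ < 1 := by
  by_contra! hge
  obtain ⟨x, hx⟩ := hμ.exists_hasEigenvector
  have hx' : f x - ℓ x • ρ = μ • x := hx.apply_eq_smul
  have hℓf : ℓ (f x) = ℓ x := LinearMap.congr_fun h.comp_functional x
  have hℓx : ℓ x = 0 := by
    have := congrArg ℓ hx'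
    rw [map_sub, map_smul, map_smul, h.pairing, hℓf, smul_eq_mul, mul_one, sub_self, eq_comm,
      smul_eq_zero] at this
    exact this.resolve_left (norm_pos_iff.1 (one_pos.trans_le hge))
  obtain ⟨c, rfl⟩ := h.gap μ x (by rw [← hx', hℓx, zero_smul, sub_zero]) hge
  rw [map_smul, h.pairing, smul_eq_mul, mul_one] at hℓx
  exact hx.2 (by rw [hℓx, zero_smul])

theorem comp_pow (h : IsDominantPair f ρ ℓ) (k : ℕ) : ℓ ∘ₗ (f ^ k) = ℓ := by
  induction k with
  | zero => rfl
  | succ k ih =>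
    rw [pow_succ, Module.End.mul_eq_comp, ← LinearMap.comp_assoc, ih, h.comp_functional]

end Algebraic

variable {V : Type*} [NormedAddCommGroup V] [NormedSpace ℂ V] [FiniteDimensional ℂ V]
  {f : Module.End ℂ V} {ρ : V} {ℓ : Module.Dual ℂ V}

theorem tendsto_pow (h : IsDominantPair f ρ ℓ) :
    Tendsto (fun k : ℕ => Module.End.toContinuousLinearMap V (f ^ k)) atTop
      (𝓝 (Module.End.toContinuousLinearMap V (ℓ.smulRight ρ))) := by
  have hpow : ∀ k, (f - ℓ.smulRight ρ) ^ (k + 1) = f ^ (k + 1) - ℓ.smulRight ρ :=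
    sub_pow_succ_of_mul_eq (by ext; simp [h.map_vector])
      (by ext x; simpa using congrArg (· • ρ) (LinearMap.congr_fun h.comp_functional x))
      (by ext; simp [h.pairing])
  have hlim := (tendsto_add_atTop_iff_nat 1).2
    (tendsto_end_pow_zero fun μ => h.norm_eigenvalue_sub_lt_one (μ := μ))
  simp only [hpow, map_sub] at hlim
  exact (tendsto_add_atTop_iff_nat 1).1 (tendsto_sub_nhds_zero_iff.1 hlim)

theorem tendsto_trace_pow (h : IsDominantPair f ρ ℓ) :
    Tendsto (fun k : ℕ => LinearMap.trace ℂ V (f ^ k)) atTop (𝓝 1) := by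
  have := tendsto_linearMap_end h.tendsto_pow (LinearMap.trace ℂ V)
  rwa [LinearMap.trace_smulRight, h.pairing] at this

theorem eq_smul_of_comp_pow_eq (h : IsDominantPair f ρ ℓ) {φ : Module.Dual ℂ V} {m : ℕ}
    (hm : m ≠ 0) (hφ : φ ∘ₗ (f ^ m) = φ) : φ = φ ρ • ℓ := by
  ext x
  have hconst : ∀ k, φ ((f ^ (m * k)) x) = φ x := fun k => by
    induction k with
    | zero => simp
    | succ k ih =>
      rw [mul_add_one, add_comm, pow_add, Module.End.mul_apply]
      exact (LinearMap.congr_fun hφ _).trans ih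
  have hlim := (tendsto_linearMap_end h.tendsto_pow (φ ∘ₗ LinearMap.applyₗ x)).comp
    (tendsto_id.const_mul_atTop' (Nat.pos_of_ne_zero hm))
  have := tendsto_nhds_unique (hlim.congr hconst) tendsto_const_nhds
  simpa [mul_comm] using this.symm

theorem eq_smul_of_bounded_preimages (h : IsDominantPair f ρ ℓ) {x : V} {C : ℝ}
    (hx : ∀ k : ℕ, ∃ z : V, ‖z‖ ≤ C ∧ (f ^ k) z = x) : x = ℓ x • ρ := by
  choose z hzC hz using hx
  have hℓ : ∀ k, ℓ (z k) = ℓ x := fun k => by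
    rw [← hz k]
    exact (LinearMap.congr_fun (h.comp_pow k) (z k)).symm
  have hlim := (tendsto_iff_norm_sub_tendsto_zero.1 h.tendsto_pow).mul_const C
  rw [zero_mul] at hlim
  refine sub_eq_zero.1 (norm_le_zero_iff.1 (ge_of_tendsto' hlim fun k => ?_))
  calc ‖x - ℓ x • ρ‖
      = ‖(Module.End.toContinuousLinearMap V (f ^ k) -
          Module.End.toContinuousLinearMap V (ℓ.smulRight ρ)) (z k)‖ := by
        change _ = ‖(f ^ k) (z k) - ℓ (z k) • ρ‖
        rw [hz, hℓ]
    _ ≤ _ := ContinuousLinearMap.le_opNorm_of_le _ (hzC k)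

theorem eq_smul_of_bounded_orbit (h : IsDominantPair f ρ ℓ) {x : ℤ → V} {z : ℤ → Circle} {C : ℝ}
    (hx : ∀ j, f (x j) = (z j : ℂ) • x (j - 1)) (hC : ∀ j, ‖x j‖ ≤ C) (j : ℤ) :
    x j = ℓ (x j) • ρ := by
  refine h.eq_smul_of_bounded_preimages (C := C) fun k => ?_
  suffices ∃ c : Circle, (f ^ k) ((c : ℂ) • x (j + k)) = x j by
    obtain ⟨c, hc⟩ := this
    exact ⟨_, by rw [norm_smul, c.norm_coe, one_mul]; exact hC _, hc⟩
  induction k with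
  | zero => exact ⟨1, by simp⟩
  | succ k ih =>
    obtain ⟨c, hc⟩ := ih
    refine ⟨c * (z (j + (k + 1 : ℕ)))⁻¹, ?_⟩
    rw [pow_succ, Module.End.mul_apply, map_smul, hx, smul_smul, ← Circle.coe_mul,
      inv_mul_cancel_right, ← hc]
    push_cast
    rw [← add_assoc, add_sub_cancel_right]

end IsDominantPair

section Phases

theorem eqPhase_iff {M : Type*} [SMul ℂ M] {x y : M} : EqPhase x y ↔ ∃ z : Circle, x = z • y :=
  ⟨fun ⟨z, hz, h⟩ => ⟨⟨z, mem_sphere_zero_iff_norm.2 hz⟩, h⟩, fun ⟨z, h⟩ => ⟨z, z.norm_coe, h⟩⟩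

theorem EqPhase.refl {M : Type*} [MulAction ℂ M] (x : M) : EqPhase x x :=
  ⟨1, norm_one, (one_smul ℂ x).symm⟩

variable (n : ℕ)

/-- The phases `U(1)`, as the central subgroup of scalar matrices in the unitary group. -/
noncomputable def scalarUnitary : Circle →* Unitary n where
  toFun z := ⟨z • 1, by
    rw [Matrix.mem_unitaryGroup_iff', Circle.smul_def, star_smul, star_one, smul_mul_smul_comm,
      one_mul, RCLike.star_def, ← Circle.coe_inv_eq_conj, ← Circle.coe_mul, inv_mul_cancel,
      Circle.coe_one, one_smul]⟩
  map_one' := Subtype.ext (one_smul Circle 1)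
  map_mul' z w := Subtype.ext (by simp [smul_smul, mul_comm])

variable {n}

theorem coe_scalarUnitary (z : Circle) :
    (scalarUnitary n z : Matrix (Fin n) (Fin n) ℂ) = z • 1 := rfl

theorem coe_scalarUnitary_mul (z : Circle) (u : Unitary n) :
    ((scalarUnitary n z * u : Unitary n) : Matrix (Fin n) (Fin n) ℂ) =
      z • (u : Matrix (Fin n) (Fin n) ℂ) := by
  rw [Submonoid.coe_mul, coe_scalarUnitary, smul_mul_assoc, one_mul]

theorem scalarUnitary_commute (z : Circle) (u : Unitary n) : Commute (scalarUnitary n z) u :=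
  Subtype.ext (by simp [coe_scalarUnitary])

theorem scalarUnitary_injective [NeZero n] : Function.Injective (scalarUnitary n) := fun z w h => by
  have := congrFun₂ (congrArg Subtype.val h) 0 0
  simpa [coe_scalarUnitary, Circle.smul_def, Circle.ext_iff] using this

theorem eqPhase_coe_iff {u v : Unitary n} :
    EqPhase (u : Matrix (Fin n) (Fin n) ℂ) (v : Matrix (Fin n) (Fin n) ℂ) ↔
      ∃ z, u = scalarUnitary n z * v := by
  simp only [eqPhase_iff, Subtype.ext_iff, coe_scalarUnitary_mul]

instance : (scalarUnitary n).range.Normal where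
  conj_mem := by
    rintro _ ⟨z, rfl⟩ u
    exact ⟨z, by rw [← (scalarUnitary_commute z u).eq, mul_inv_cancel_right]⟩

theorem isZN_iff {N : ℕ} {U : ℤ → Unitary n} :
    IsZN N U ↔ ∀ j, U j ^ N ∈ (scalarUnitary n).range :=
  forall_congr' fun j => by
    simpa [MonoidHom.mem_range, eq_comm] using eqPhase_coe_iff (u := U j ^ N) (v := 1)

end Phases

section RootPhase

variable (N : ℕ) [NeZero N]

theorem rootPhase_eq_toCircle (k : ℤ) : rootPhase N k = ZMod.toCircle (k : ZMod N) :=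
  (ZMod.toCircle_intCast k).symm

theorem exists_toCircle_eq_of_pow_eq_one {c : Circle} (h : c ^ N = 1) :
    ∃ k : ℤ, c = ZMod.toCircle (k : ZMod N) := by
  obtain ⟨k, -, hk⟩ := (Complex.isPrimitiveRoot_exp N (NeZero.ne N)).eq_pow_of_pow_eq_one
    (by exact_mod_cast congrArg Circle.coeHom h : (c : ℂ) ^ N = 1)
  refine ⟨k, Circle.ext ?_⟩
  rw [← hk, ← Complex.exp_nat_mul, ZMod.toCircle_intCast]
  push_cast
  ring_nf

theorem toCircle_intCast_eq_iff (k l : ℤ) :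
    ZMod.toCircle (k : ZMod N) = ZMod.toCircle (l : ZMod N) ↔ k ≡ l [ZMOD N] :=
  ZMod.injective_toCircle.eq_iff.trans (ZMod.intCast_eq_intCast_iff k l N)

theorem toCircle_intCast_eq_one_iff (k : ℤ) : ZMod.toCircle (k : ZMod N) = 1 ↔ (N : ℤ) ∣ k := by
  rw [← ZMod.intCast_zmod_eq_zero_iff_dvd, ← AddChar.map_zero_eq_one (ZMod.toCircle (N := N)),
    ZMod.injective_toCircle.eq_iff]

end RootPhase

section Commutators

open scoped commutatorElement

variable {G : Type*} [Group G]

theorem commutatorElement_mul_mul_right {q b z : G} (hz : ∀ g, Commute z g) :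
    ⁅q, z * (b * q)⁆ = ⁅q, b⁆ := by
  calc ⁅q, z * (b * q)⁆ = z * ⁅q, b⁆ * z⁻¹ := by
        rw [commutatorElement_def, commutatorElement_def, ← mul_assoc q, ← (hz q).eq]
        group
    _ = ⁅q, b⁆ := by rw [(hz _).eq, mul_inv_cancel_right]

theorem mul_pow_mem_of_commutatorElement_mem {H : Subgroup G} [H.Normal] {a b : G} {N : ℕ}
    (hab : ⁅a, b⁆ ∈ H) (ha : a ^ N ∈ H) (hb : b ^ N ∈ H) : (a * b) ^ N ∈ H := by
  have mem_iff {g : G} : g ∈ H ↔ QuotientGroup.mk' H g = 1 := (QuotientGroup.eq_one_iff g).symm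
  simp only [mem_iff, map_pow, map_mul, map_commutatorElement,
    commutatorElement_eq_one_iff_commute] at *
  rw [hab.mul_pow, ha, hb, one_mul]

theorem mul_zpow_eq {x z c : G} (hc : ∀ g, Commute c g) (h : z * x = c * (x * z)) (j : ℤ) :
    z * x ^ j = c ^ j * (x ^ j * z) := by
  have hsemi : SemiconjBy z x (c * x) := h.trans (mul_assoc c x z).symm
  rw [(hsemi.zpow_right j).eq, (hc x).mul_zpow, mul_assoc]

theorem zpow_mul_zpow_eq {x z c : G} (hc : ∀ g, Commute c g) (h : z * x = c * (x * z))
    (m j : ℤ) : z ^ m * x ^ j = c ^ (m * j) * (x ^ j * z ^ m) := by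
  have hswap : x ^ j * z = (c ^ j)⁻¹ * (z * x ^ j) := by
    rw [mul_zpow_eq hc h, inv_mul_cancel_left]
  rw [mul_zpow_eq (fun g => ((hc g).zpow_left j).inv_left) hswap m, inv_zpow, ← zpow_mul,
    mul_comm j, mul_inv_cancel_left]

end Commutators

section Transfer

variable {d χ : ℕ}

theorem transfer_apply (A : Tensor d χ) (X : Matrix (Fin χ) (Fin χ) ℂ) :
    transfer A X = ∑ s, A s * X * (A s)ᴴ := rfl

theorem transferLeft_apply (A : Tensor d χ) (X : Matrix (Fin χ) (Fin χ) ℂ) :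
    transferLeft A X = ∑ s, (A s)ᴴ * X * A s := by
  simp only [transferLeft, transfer_apply, Matrix.conjTranspose_conjTranspose]

theorem trace_mul_transfer (A : Tensor d χ) (X Y : Matrix (Fin χ) (Fin χ) ℂ) :
    (X * transfer A Y).trace = (transferLeft A X * Y).trace := by
  simp only [transfer_apply, transferLeft_apply, Matrix.mul_sum, Matrix.sum_mul, Matrix.trace_sum]
  refine Finset.sum_congr rfl fun s _ => ?_
  rw [← Matrix.mul_assoc, Matrix.trace_mul_comm]
  simp only [Matrix.mul_assoc]

open scoped MatrixOrder in
theorem exists_eq_conjTranspose_mul_self {𝕜 n : Type*} [RCLike 𝕜] [Fintype n] [DecidableEq n]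
    {X : Matrix n n 𝕜} (hX : X.PosDef) : ∃ S : Matrix n n 𝕜, IsUnit S ∧ X = Sᴴ * S := by
  obtain ⟨S, hS⟩ := CStarAlgebra.nonneg_iff_eq_star_mul_self.1 hX.posSemidef.nonneg
  exact ⟨S, isUnit_of_mul_isUnit_right (hS ▸ hX.isUnit), hS⟩

theorem trace_mul_pos {𝕜 n : Type*} [RCLike 𝕜] [Fintype n] [Nonempty n] {X Y : Matrix n n 𝕜}
    (hX : X.PosDef) (hY : Y.PosDef) : 0 < (X * Y).trace := by
  classical
  obtain ⟨S, hS, rfl⟩ := exists_eq_conjTranspose_mul_self hX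
  rw [Matrix.mul_assoc, Matrix.trace_mul_comm]
  exact (hY.mul_mul_conjTranspose_same (Matrix.vecMul_injective_of_isUnit hS)).trace_pos

/-- The functional `X ↦ Tr (Q X)` on bond matrices. -/
noncomputable def traceDual (Q : Matrix (Fin χ) (Fin χ) ℂ) :
    Module.Dual ℂ (Matrix (Fin χ) (Fin χ) ℂ) :=
  Matrix.traceLinearMap (Fin χ) ℂ ℂ ∘ₗ LinearMap.mulLeft ℂ Q

theorem traceDual_apply (Q X : Matrix (Fin χ) (Fin χ) ℂ) : traceDual Q X = (Q * X).trace := rfl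

theorem traceDual_smul (c : ℂ) (Q : Matrix (Fin χ) (Fin χ) ℂ) :
    traceDual (c • Q) = c • traceDual Q := by
  ext1 X
  simp [traceDual_apply]

theorem traceDual_injective : Function.Injective (traceDual (χ := χ)) := fun _ _ h =>
  Matrix.ext_iff_trace_mul_right.2 fun X => LinearMap.congr_fun h X

theorem traceDual_comp_transfer (A : Tensor d χ) (Q : Matrix (Fin χ) (Fin χ) ℂ) :
    traceDual Q ∘ₗ transfer A = traceDual (transferLeft A Q) :=
  LinearMap.ext fun X => trace_mul_transfer A Q X

theorem traceDual_comp_transfer_pow (A : Tensor d χ) (Q : Matrix (Fin χ) (Fin χ) ℂ) (m : ℕ) :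
    traceDual Q ∘ₗ transfer A ^ m = traceDual ((transferLeft A ^ m) Q) := by
  induction m generalizing Q with
  | zero => rfl
  | succ m ih =>
    rw [pow_succ', Module.End.mul_eq_comp, ← LinearMap.comp_assoc, traceDual_comp_transfer, ih,
      pow_succ, Module.End.mul_apply]

theorem IsInjective.neZero {A : Tensor d χ} (hA : IsInjective A) : NeZero χ := by
  refine ⟨?_⟩
  rintro rfl
  obtain ⟨r, ρ, Λ, -, -, -, hρ, -⟩ := hA
  exact hρ.2 (Subsingleton.elim _ _)

theorem IsInjective.exists_isDominantPair {A : Tensor d χ} (hA : IsInjective A) :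
    ∃ (r : ℂ) (ρ : Matrix (Fin χ) (Fin χ) ℂ) (ℓ : _), r ≠ 0 ∧ ρ.PosDef ∧
      IsDominantPair (r⁻¹ • transfer A) ρ ℓ := by
  have := hA.neZero
  obtain ⟨r, ρ, Λ, hr, hρ, hΛ, eρ, eΛ, gap⟩ := hA
  have hr' : (r : ℂ) ≠ 0 := mod_cast hr.ne'
  refine ⟨r, ρ, _, hr', hρ, .of_eigenvectors (ℓ := traceDual Λ) hr' eρ.apply_eq_smul ?_
    (trace_mul_pos hΛ hρ).ne' fun μ X hX hμ => ?_⟩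
  · rw [traceDual_comp_transfer, eΛ.apply_eq_smul, traceDual_smul]
  · rcases eq_or_ne X 0 with rfl | hX0
    · exact ⟨0, (zero_smul ℂ ρ).symm⟩
    · exact (gap μ X ⟨Module.End.mem_eigenspace_iff.2 hX, hX0⟩
        (by simpa [abs_of_pos hr] using hμ)).2

theorem isLeftCanonical_iff {A : Tensor d χ} : IsLeftCanonical A ↔ transferLeft A 1 = 1 := by
  simp only [IsLeftCanonical, transferLeft_apply, Matrix.mul_one]

theorem IsLeftCanonical.transferLeft_one {A : Tensor d χ} (hA : IsLeftCanonical A) :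
    transferLeft A 1 = 1 :=
  isLeftCanonical_iff.1 hA

theorem IsLeftCanonical.exists_isDominantPair {A : Tensor d χ} (hL : IsLeftCanonical A)
    (hA : IsInjective A) :
    ∃ (ρ : Matrix (Fin χ) (Fin χ) ℂ) (ℓ : _), ρ.PosDef ∧ IsDominantPair (transfer A) ρ ℓ := by
  have := hA.neZero
  obtain ⟨r, ρ, ℓ, hr, hρ, h⟩ := hA.exists_isDominantPair
  have htr : r * ρ.trace = ρ.trace := by
    have := trace_mul_transfer A 1 ρ
    rwa [hL.transferLeft_one, (inv_smul_eq_iff₀ hr).1 h.map_vector, Matrix.one_mul, Matrix.one_mul,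
      Matrix.trace_smul] at this
  have hr1 : r = 1 := (mul_eq_right₀ hρ.trace_pos.ne').1 htr
  exact ⟨ρ, ℓ, hρ, by simpa [hr1] using h⟩

open scoped Matrix.Norms.L2Operator in
theorem IsLeftCanonical.eq_smul_one_of_transferLeft_pow_eq {A : Tensor d χ} (hL : IsLeftCanonical A)
    (hA : IsInjective A) {Q : Matrix (Fin χ) (Fin χ) ℂ} {m : ℕ} (hm : m ≠ 0)
    (hQ : (transferLeft A ^ m) Q = Q) : ∃ c : ℂ, Q = c • 1 := by
  have := hA.neZero
  obtain ⟨ρ, ℓ, hρ, h⟩ := hL.exists_isDominantPair hA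
  have hQℓ := h.eq_smul_of_comp_pow_eq hm (φ := traceDual Q)
    (by rw [traceDual_comp_transfer_pow, hQ])
  have h1ℓ := h.eq_smul_of_comp_pow_eq one_ne_zero (φ := traceDual 1)
    (by rw [traceDual_comp_transfer_pow, pow_one, hL.transferLeft_one])
  have hρ0 : traceDual 1 ρ ≠ 0 := by
    rw [traceDual_apply, Matrix.one_mul]
    exact hρ.trace_pos.ne'
  refine ⟨traceDual Q ρ * (traceDual 1 ρ)⁻¹, traceDual_injective ?_⟩
  calc traceDual Q = traceDual Q ρ • ℓ := hQℓ
    _ = traceDual Q ρ • (traceDual 1 ρ)⁻¹ • traceDual 1 := by rw [(inv_smul_eq_iff₀ hρ0).2 h1ℓ]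
    _ = _ := by rw [traceDual_smul, smul_smul]

end Transfer

section BondUnitaries

variable {d χ : ℕ}

theorem act_mul (U V : Unitary d) (A : Tensor d χ) : act (U * V) A = act U (act V A) := by
  ext1 s
  simp only [act, Submonoid.coe_mul, Matrix.mul_apply, Finset.sum_smul, Finset.smul_sum, mul_smul]
  exact Finset.sum_comm

theorem act_one (A : Tensor d χ) : act 1 A = A := by
  ext1 s
  simp [act, Matrix.one_apply]

theorem act_smul (U : Unitary d) (z : Circle) (A : Tensor d χ) : act U (z • A) = z • act U A := by
  ext1 s
  simp only [act, Circle.smul_def, Pi.smul_apply, Finset.smul_sum]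
  exact Finset.sum_congr rfl fun t _ => smul_comm _ _ _

theorem act_scalarUnitary_mul (z : Circle) (U : Unitary d) (A : Tensor d χ) :
    act (scalarUnitary d z * U) A = z • act U A := by
  ext1 s
  simp only [act, coe_scalarUnitary_mul, Circle.smul_def, Matrix.smul_apply, Pi.smul_apply,
    Finset.smul_sum, smul_assoc]

/-- The tensor `u† A v`, obtained from `A` by unitaries on the bonds to its left and to its
right: the right-hand side of the push-through relation. -/
noncomputable def bondAct (u v : Unitary χ) (A : Tensor d χ) : Tensor d χ :=
  fun s => (u : Matrix (Fin χ) (Fin χ) ℂ)ᴴ * A s * (v : Matrix (Fin χ) (Fin χ) ℂ)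

theorem bondAct_one (A : Tensor d χ) : bondAct 1 1 A = A := by
  ext1 s
  simp [bondAct]

theorem bondAct_mul (u u' v v' : Unitary χ) (A : Tensor d χ) :
    bondAct (u * u') (v * v') A = bondAct u' v' (bondAct u v A) := by
  ext1 s
  simp only [bondAct, Submonoid.coe_mul, Matrix.conjTranspose_mul, Matrix.mul_assoc]

theorem bondAct_smul (u v : Unitary χ) (z : Circle) (A : Tensor d χ) :
    bondAct u v (z • A) = z • bondAct u v A := by
  ext1 s
  simp only [bondAct, Circle.smul_def, Pi.smul_apply, mul_smul_comm, smul_mul_assoc]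

theorem bondAct_scalarUnitary_mul (z w : Circle) (u v : Unitary χ) (A : Tensor d χ) :
    bondAct (scalarUnitary χ z * u) (scalarUnitary χ w * v) A = (z⁻¹ * w) • bondAct u v A := by
  ext1 s
  simp only [bondAct, coe_scalarUnitary_mul, Pi.smul_apply, Circle.smul_def,
    Matrix.conjTranspose_smul, Matrix.smul_mul, Matrix.mul_smul, smul_smul, Circle.coe_mul,
    Circle.coe_inv_eq_conj, RCLike.star_def, mul_comm]

theorem act_bondAct (U : Unitary d) (u v : Unitary χ) (A : Tensor d χ) :
    act U (bondAct u v A) = bondAct u v (act U A) := by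
  ext1 s
  simp only [act, bondAct, Matrix.mul_sum, Matrix.sum_mul, mul_smul_comm, smul_mul_assoc]

theorem act_mul_eq_smul_bondAct {U V : Unitary d} {u u' v v' : Unitary χ} {A : Tensor d χ}
    {a b : Circle} (hU : act U A = a • bondAct u u' A) (hV : act V A = b • bondAct v v' A) :
    act (U * V) A = (a * b) • bondAct (u * v) (u' * v') A := by
  rw [act_mul, hV, act_smul, act_bondAct, hU, bondAct_smul, ← bondAct_mul, smul_smul, mul_comm]

theorem pushesThrough_iff {A : Tensor d χ} {U : ℤ → Unitary d} {v : ℤ → Unitary χ} :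
    PushesThrough A U v ↔ ∀ j, ∃ z : Circle, act (U j) A = z • bondAct (v (j - 1)) (v j) A :=
  forall_congr' fun _ => eqPhase_iff

namespace PushesThrough

variable {A : Tensor d χ} {U V : ℤ → Unitary d} {u v : ℤ → Unitary χ}

theorem one : PushesThrough A (fun _ => 1) (fun _ => 1) :=
  pushesThrough_iff.2 fun _ => ⟨1, by rw [act_one, bondAct_one, one_smul]⟩

theorem mul (hU : PushesThrough A U u) (hV : PushesThrough A V v) :
    PushesThrough A (fun j => U j * V j) (fun j => u j * v j) :=
  pushesThrough_iff.2 fun j =>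
    let ⟨a, ha⟩ := pushesThrough_iff.1 hU j
    let ⟨b, hb⟩ := pushesThrough_iff.1 hV j
    ⟨a * b, act_mul_eq_smul_bondAct ha hb⟩

theorem pow (hU : PushesThrough A U u) (m : ℕ) :
    PushesThrough A (fun j => U j ^ m) (fun j => u j ^ m) := by
  induction m with
  | zero => simpa only [pow_zero] using one
  | succ m ih => simpa only [pow_succ] using ih.mul hU

theorem shift (hU : PushesThrough A U u) (m : ℤ) :
    PushesThrough A (fun j => U (j - m)) (fun j => u (j - m)) := fun j => by
  simpa only [sub_right_comm] using hU (j - m)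

theorem scalarUnitary_mul (hU : PushesThrough A U u) (z : ℤ → Circle) :
    PushesThrough A (fun j => scalarUnitary d (z j) * U j) u :=
  pushesThrough_iff.2 fun j =>
    let ⟨a, ha⟩ := pushesThrough_iff.1 hU j
    ⟨z j * a, by rw [act_scalarUnitary_mul, ha, smul_smul]⟩

end PushesThrough

theorem mem_range_scalarUnitary_of_mul_eq_smul {ρ : Matrix (Fin χ) (Fin χ) ℂ} [NeZero χ]
    (hρ : IsUnit ρ) {u : Unitary χ} {c : ℂ} (h : (u : Matrix (Fin χ) (Fin χ) ℂ) * ρ = c • ρ) :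
    u ∈ (scalarUnitary χ).range := by
  have hu : (u : Matrix (Fin χ) (Fin χ) ℂ) = c • 1 :=
    hρ.mul_right_cancel (by rw [h, smul_mul_assoc, one_mul])
  have hc : ‖c‖ = 1 := by
    open scoped Matrix.Norms.L2Operator in
    simpa [hu, norm_smul] using CStarRing.norm_coe_unitary u
  exact ⟨⟨c, mem_sphere_zero_iff_norm.2 hc⟩, Subtype.ext hu.symm⟩

theorem transfer_mul_of_bondAct_eq {A : Tensor d χ} {u v : Unitary χ} {z : Circle}
    (h : bondAct u v A = z • A) (X : Matrix (Fin χ) (Fin χ) ℂ) :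
    transfer A (v * X) = z • ((u : Matrix (Fin χ) (Fin χ) ℂ) * transfer A X) := by
  have hs : ∀ s, A s * (v : Matrix (Fin χ) (Fin χ) ℂ) =
      z • ((u : Matrix (Fin χ) (Fin χ) ℂ) * A s) := fun s => by
    have : _ = z • A s := congrFun h s
    rw [← mul_smul_comm, ← this, bondAct, Matrix.mul_assoc, ← Matrix.mul_assoc,
      ← Matrix.star_eq_conjTranspose, Unitary.mul_star_self_of_mem u.2, Matrix.one_mul]
  simp only [transfer_apply, ← Matrix.mul_assoc, hs, Matrix.mul_sum, Finset.smul_sum,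
    smul_mul_assoc]

open scoped Matrix.Norms.L2Operator in
theorem IsInjective.mem_range_scalarUnitary {A : Tensor d χ} (hA : IsInjective A)
    {u : ℤ → Unitary χ} {z : ℤ → Circle} (h : ∀ j, bondAct (u (j - 1)) (u j) A = z j • A) (j : ℤ) :
    u j ∈ (scalarUnitary χ).range := by
  have := hA.neZero
  obtain ⟨r, ρ, ℓ, -, hρ, hdom⟩ := hA.exists_isDominantPair
  have horbit : ∀ j, (r⁻¹ • transfer A) ((u j : Matrix (Fin χ) (Fin χ) ℂ) * ρ) =
      (z j : ℂ) • ((u (j - 1) : Matrix (Fin χ) (Fin χ) ℂ) * ρ) := fun j => by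
    rw [LinearMap.smul_apply, transfer_mul_of_bondAct_eq (h j), Circle.smul_def, smul_comm,
      ← mul_smul_comm, ← LinearMap.smul_apply, hdom.map_vector]
  exact mem_range_scalarUnitary_of_mul_eq_smul hρ.isUnit
    (hdom.eq_smul_of_bounded_orbit horbit (fun j => (CStarRing.norm_coe_unitary_mul (u j) ρ).le) j)

theorem PushesThrough.eqPhase {A : Tensor d χ} {U : ℤ → Unitary d} {u v : ℤ → Unitary χ}
    (hA : IsInjective A) (hu : PushesThrough A U u) (hv : PushesThrough A U v) (j : ℤ) :
    EqPhase (u j : Matrix (Fin χ) (Fin χ) ℂ) (v j : Matrix (Fin χ) (Fin χ) ℂ) := by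
  choose a ha using pushesThrough_iff.1 hu
  choose b hb using pushesThrough_iff.1 hv
  have hquot : ∀ j, bondAct (u (j - 1) * (v (j - 1))⁻¹) (u j * (v j)⁻¹) A =
      ((a j)⁻¹ * b j) • A := fun j => by
    have huv : bondAct (u (j - 1)) (u j) A = ((a j)⁻¹ * b j) • bondAct (v (j - 1)) (v j) A := by
      rw [← smul_smul, ← hb, ha, inv_smul_smul]
    rw [bondAct_mul, huv, bondAct_smul, ← bondAct_mul, mul_inv_cancel, mul_inv_cancel, bondAct_one]
  obtain ⟨z, hz⟩ := hA.mem_range_scalarUnitary (u := fun j => u j * (v j)⁻¹) hquot j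
  exact eqPhase_coe_iff.2 ⟨z, by rw [hz, inv_mul_cancel_right]⟩

theorem IsInjective.bondAct_ne_zero {A : Tensor d χ} (hA : IsInjective A) (u v : Unitary χ) :
    bondAct u v A ≠ 0 := by
  have := hA.neZero
  obtain ⟨r, ρ, ℓ, -, hρ, hdom⟩ := hA.exists_isDominantPair
  intro h
  have hAs : ∀ s, A s = 0 := fun s => by
    have hinv : bondAct u⁻¹ v⁻¹ (bondAct u v A) = A := by
      rw [← bondAct_mul, mul_inv_cancel, mul_inv_cancel, bondAct_one]
    rw [← hinv, h]
    simp [bondAct]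
  have hρ0 : ρ = 0 := by
    rw [← hdom.map_vector]
    simp [transfer_apply, hAs]
  exact hρ.trace_pos.ne' (by rw [hρ0, Matrix.trace_zero])

section Dipole

variable {A : Tensor d χ} {Uq Ud : ℤ → Unitary d} {vq : Unitary χ} {vd : ℤ → Unitary χ}

theorem PushesThrough.eqPhase_mul_of_translate (hA : IsInjective A)
    (hU : ∀ j, Ud j = Ud (j - 1) * Uq (j - 1)) (hq : PushesThrough A Uq fun _ => vq)
    (hd : PushesThrough A Ud vd) (j : ℤ) :
    EqPhase (vd j : Matrix (Fin χ) (Fin χ) ℂ)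
      ((vd (j - 1) : Matrix (Fin χ) (Fin χ) ℂ) * (vq : Matrix (Fin χ) (Fin χ) ℂ)) := by
  have hprod := (hd.shift 1).mul (hq.shift 1)
  simp only [← hU] at hprod
  exact hd.eqPhase hA hprod j

theorem bondInvariant_eq_of_eqPhase_mul {v w : Unitary χ}
    (h : EqPhase (w : Matrix (Fin χ) (Fin χ) ℂ)
      ((v : Matrix (Fin χ) (Fin χ) ℂ) * (vq : Matrix (Fin χ) (Fin χ) ℂ))) :
    bondInvariant vq w = bondInvariant vq v := by
  rw [← Submonoid.coe_mul] at h
  obtain ⟨z, rfl⟩ := eqPhase_coe_iff.1 h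
  exact commutatorElement_mul_mul_right (scalarUnitary_commute z)

theorem PushesThrough.exists_bondInvariant_eq {ω : Circle} (hA : IsInjective A)
    (hU : ∀ j, Uq j * Ud j = scalarUnitary d ω * (Ud j * Uq j))
    (hq : PushesThrough A Uq fun _ => vq) (hd : PushesThrough A Ud vd) :
    ∃ c : ℤ → Circle, (∀ j, bondInvariant vq (vd j) = scalarUnitary χ (c j)) ∧
      ∀ j, c j = ω * c (j - 1) := by
  have hqd := hq.mul hd
  simp only [hU] at hqd
  choose c hc using fun j =>
    eqPhase_coe_iff.1 (hqd.eqPhase hA ((hd.mul hq).scalarUnitary_mul fun _ => ω) j)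
  refine ⟨c, fun j => ?_, fun j => ?_⟩
  · rw [bondInvariant, hc, mul_assoc, mul_assoc, mul_assoc]
    simp
  · obtain ⟨a, ha⟩ := pushesThrough_iff.1 hq j
    obtain ⟨b, hb⟩ := pushesThrough_iff.1 hd j
    have hphase : (a * b * ((c (j - 1))⁻¹ * c j)) • bondAct (vd (j - 1) * vq) (vd j * vq) A =
        (ω * (b * a)) • bondAct (vd (j - 1) * vq) (vd j * vq) A := by
      rw [← smul_smul, ← bondAct_scalarUnitary_mul, ← hc, ← hc, ← act_mul_eq_smul_bondAct ha hb, hU,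
        act_scalarUnitary_mul, act_mul_eq_smul_bondAct hb ha, smul_smul]
    have hscalar : a * b * ((c (j - 1))⁻¹ * c j) = ω * (b * a) := Circle.ext <|
      smul_left_injective ℂ (hA.bondAct_ne_zero (vd (j - 1) * vq) (vd j * vq)) hphase
    rwa [mul_comm ω, mul_comm b, mul_right_inj, inv_mul_eq_iff_eq_mul, mul_comm] at hscalar

theorem PushesThrough.bondInvariant_phase_pow_eq_one {N : ℕ} {c : Circle} {v : Unitary χ}
    (hA : IsInjective A) (hU : IsZN N Uq) (hq : PushesThrough A Uq fun _ => vq)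
    (hc : bondInvariant vq v = scalarUnitary χ c) : c ^ N = 1 := by
  have := hA.neZero
  have hpow : vq ^ N ∈ (scalarUnitary χ).range := by
    choose z hz using isZN_iff.1 hU
    have h1 := (PushesThrough.one (A := A)).scalarUnitary_mul z
    simp only [mul_one, hz] at h1
    obtain ⟨w, hw⟩ := eqPhase_coe_iff.1 ((hq.pow N).eqPhase hA h1 0)
    exact ⟨w, by rw [hw, mul_one]⟩
  have hcomm : vq * v = scalarUnitary χ c * (v * vq) := by
    rw [← hc, bondInvariant]
    group
  have hcommN := zpow_mul_zpow_eq (scalarUnitary_commute c) hcomm N 1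
  obtain ⟨w, hw⟩ := hpow
  rw [zpow_one, zpow_natCast, mul_one, zpow_natCast, ← hw, (scalarUnitary_commute w v).eq,
    right_eq_mul, ← map_pow] at hcommN
  exact (map_eq_one_iff _ scalarUnitary_injective).1 hcommN

theorem onSiteProjective_iff {N : ℕ} [NeZero N] {n : ℤ} :
    OnSiteProjective N n Uq Ud ↔
      ∀ j, Uq j * Ud j = scalarUnitary d (ZMod.toCircle (n : ZMod N)) * (Ud j * Uq j) := by
  simp only [OnSiteProjective, Subtype.ext_iff, rootPhase_eq_toCircle, Submonoid.coe_mul,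
    coe_scalarUnitary, smul_mul_assoc, one_mul, Circle.smul_def]

theorem PushesThrough.exists_bondInvariant_eq_rootPhase {N : ℕ} [NeZero N] {n : ℤ}
    (hA : IsInjective A) (hZN : IsZN N Uq) (hU : OnSiteProjective N n Uq Ud)
    (hq : PushesThrough A Uq fun _ => vq) (hd : PushesThrough A Ud vd) :
    ∃ k : ℤ → ℤ,
      (∀ j, (bondInvariant vq (vd j) : Matrix (Fin χ) (Fin χ) ℂ) = rootPhase N (k j) • 1) ∧
      ∀ j, k j ≡ k (j - 1) + n [ZMOD N] := by
  obtain ⟨c, hc, hstep⟩ := hq.exists_bondInvariant_eq hA (onSiteProjective_iff.1 hU) hd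
  choose k hk using fun j =>
    exists_toCircle_eq_of_pow_eq_one N (hq.bondInvariant_phase_pow_eq_one hA hZN (hc j))
  refine ⟨k, fun j => ?_, fun j => ?_⟩
  · rw [hc, hk, rootPhase_eq_toCircle, coe_scalarUnitary, Circle.smul_def]
  · rw [← toCircle_intCast_eq_iff, ← hk, hstep, hk, Int.cast_add, AddChar.map_add_eq_mul, mul_comm]

end Dipole

end BondUnitaries

section CyclicProducts

variable {R V : Type*} [CommRing R] [AddCommGroup V] [Module R V] {L : ℕ}

/-- The backward cyclic shift on `⨁ⱼ V`, `j ∈ ℤ/L`, twisted by endomorphisms `E j` that carry the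
component at `j` to the component at `j - 1`. Its powers collect the ordered products of the
`E j`, and its eigenvectors are the families with `E j (x j) = μ • x (j - 1)`. -/
def twistedShift (E : ZMod L → Module.End R V) : Module.End R (ZMod L → V) :=
  LinearMap.pi fun j => E (j + 1) ∘ₗ LinearMap.proj (j + 1)

theorem twistedShift_apply (E : ZMod L → Module.End R V) (x : ZMod L → V) (j : ZMod L) :
    twistedShift E x j = E (j + 1) (x (j + 1)) := rfl

theorem twistedShift_pow_apply (E : ZMod L → Module.End R V) (m : ℕ) (x : ZMod L → V)
    (j : ZMod L) :
    (twistedShift E ^ m) x j =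
      (List.ofFn fun i : Fin m => E (j + (i : ℕ) + 1)).prod (x (j + (m : ℕ))) := by
  induction m generalizing j with
  | zero => simp
  | succ m ih =>
    rw [pow_succ', Module.End.mul_apply, twistedShift_apply, ih, List.ofFn_succ, List.prod_cons,
      Module.End.mul_apply]
    simp [add_comm, add_left_comm]

/-- The trace of the diagonal block at `0` of an endomorphism of `⨁ⱼ V`. -/
noncomputable def traceBlockZero :
    Module.End R (ZMod L → V) →ₗ[R] R where
  toFun F := LinearMap.trace R V
    (LinearMap.proj (0 : ZMod L) ∘ₗ F ∘ₗ LinearMap.single R (fun _ : ZMod L => V) 0)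
  map_add' F G := by rw [LinearMap.add_comp, LinearMap.comp_add, map_add]
  map_smul' c F := by rw [LinearMap.smul_comp, LinearMap.comp_smul, map_smul, RingHom.id_apply]

theorem traceBlockZero_twistedShift_pow (E : ZMod L → Module.End R V) (k : ℕ) :
    traceBlockZero (twistedShift E ^ (k * L)) =
      LinearMap.trace R V (List.ofFn fun i : Fin (k * L) => E ((i : ℕ) + 1)).prod := by
  refine congrArg (LinearMap.trace R V) (LinearMap.ext fun x => ?_)
  simp [twistedShift_pow_apply]

theorem exists_twisted_eigenvector [NeZero L] {V : Type*} [NormedAddCommGroup V] [NormedSpace ℂ V]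
    [FiniteDimensional ℂ V] {E : ZMod L → Module.End ℂ V}
    (h : ¬ Tendsto (fun k => LinearMap.trace ℂ V
      (List.ofFn fun i : Fin (k * L) => E ((i : ℕ) + 1)).prod) atTop (𝓝 0)) :
    ∃ (μ : ℂ) (x : ZMod L → V), 1 ≤ ‖μ‖ ∧ x ≠ 0 ∧ ∀ j, E j (x j) = μ • x (j - 1) := by
  by_contra! hne
  have hgap : ∀ μ, (twistedShift E).HasEigenvalue μ → ‖μ‖ < 1 := fun μ hμ => by
    by_contra! hge
    obtain ⟨x, hx⟩ := hμ.exists_hasEigenvector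
    obtain ⟨j, hj⟩ := hne μ x hge hx.2
    exact hj (by simpa [twistedShift_apply] using congrFun hx.apply_eq_smul (j - 1))
  have hpow := tendsto_linearMap_end (g := 0) (F := fun k => twistedShift E ^ k)
    (by simpa only [map_zero] using tendsto_end_pow_zero hgap) traceBlockZero
  refine h ?_
  simpa only [traceBlockZero_twistedShift_pow, Function.comp_def, id, map_zero] using
    hpow.comp (tendsto_id.atTop_mul_const' (NeZero.pos L))

end CyclicProducts

section OrderedProducts

variable {R : Type*} [Semiring R] {M : ℕ}

theorem list_prod_ofFn_sum {ι : Type*} [Fintype ι] (f : Fin M → ι → R) :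
    (List.ofFn fun i => ∑ a, f i a).prod =
      ∑ s : Fin M → ι, (List.ofFn fun i => f i (s i)).prod := by
  classical
  simpa only [MultilinearMap.mkPiAlgebraFin_apply] using
    (MultilinearMap.mkPiAlgebraFin ℕ M R).map_sum f

theorem list_prod_ofFn_smul {K : Type*} [CommSemiring K] [Algebra K R] (c : Fin M → K)
    (f : Fin M → R) :
    (List.ofFn fun i => c i • f i).prod = (∏ i, c i) • (List.ofFn f).prod := by
  simpa only [MultilinearMap.mkPiAlgebraFin_apply] using
    (MultilinearMap.mkPiAlgebraFin K M R).map_smul_univ c f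

end OrderedProducts

section MixedTransfer

variable {d χ : ℕ}

/-- The operator `X ↦ P X Q†` on bond matrices, for a pair `(P, Q)`. -/
noncomputable def sandwich : Matrix (Fin χ) (Fin χ) ℂ × Matrix (Fin χ) (Fin χ) ℂ →*
    Module.End ℂ (Matrix (Fin χ) (Fin χ) ℂ) where
  toFun P := LinearMap.mulLeftRight ℂ (P.1, P.2ᴴ)
  map_one' := by ext1 X; simp
  map_mul' P Q := by ext1 X; simp [Matrix.mul_assoc]

theorem sandwich_apply (P : Matrix (Fin χ) (Fin χ) ℂ × Matrix (Fin χ) (Fin χ) ℂ)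
    (X : Matrix (Fin χ) (Fin χ) ℂ) : sandwich P X = P.1 * X * P.2ᴴ := rfl

theorem trace_sandwich (P : Matrix (Fin χ) (Fin χ) ℂ × Matrix (Fin χ) (Fin χ) ℂ) :
    LinearMap.trace ℂ _ (sandwich P) = P.1.trace * star P.2.trace := by
  rw [LinearMap.trace_eq_matrix_trace ℂ (Matrix.stdBasis ℂ (Fin χ) (Fin χ)), Matrix.trace,
    Fintype.sum_prod_type, Matrix.trace, Matrix.trace, star_sum, Finset.sum_mul_sum]
  refine Finset.sum_congr rfl fun i _ => Finset.sum_congr rfl fun j _ => ?_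
  rw [Matrix.diag_apply, LinearMap.toMatrix_apply, Matrix.stdBasis_eq_single, sandwich_apply]
  change (P.1 * Matrix.single i j (1 : ℂ) * P.2ᴴ : Matrix (Fin χ) (Fin χ) ℂ) i j = _
  rw [Matrix.mul_assoc, Matrix.mul_apply, Finset.sum_eq_single i]
  · simp
  · intro k _ hk
    simp [hk]
  · simp

theorem list_prod_ofFn_sandwich {M : ℕ} (P Q : Fin M → Matrix (Fin χ) (Fin χ) ℂ) :
    (List.ofFn fun i => sandwich (P i, Q i)).prod =
      sandwich ((List.ofFn P).prod, (List.ofFn Q).prod) := by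
  induction M with
  | zero => exact (map_one sandwich).symm
  | succ M ih => simp only [List.ofFn_succ, List.prod_cons, ih, ← map_mul, Prod.mk_mul_mk]

/-- The mixed transfer matrix `X ↦ ∑ₛ Bˢ X (Aˢ)†`. -/
noncomputable def mixedTransfer (B A : Tensor d χ) : Module.End ℂ (Matrix (Fin χ) (Fin χ) ℂ) :=
  ∑ s, sandwich (B s, A s)

theorem mixedTransfer_apply (B A : Tensor d χ) (X : Matrix (Fin χ) (Fin χ) ℂ) :
    mixedTransfer B A X = ∑ s, B s * X * (A s)ᴴ := by
  simp only [mixedTransfer, LinearMap.sum_apply, sandwich_apply]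

theorem mixedTransfer_self (A : Tensor d χ) : mixedTransfer A A = transfer A :=
  LinearMap.ext (mixedTransfer_apply A A)

theorem trace_prod_mixedTransfer {M : ℕ} (B : Fin M → Tensor d χ) (A : Tensor d χ) :
    LinearMap.trace ℂ _ (List.ofFn fun i => mixedTransfer (B i) A).prod =
      ∑ s : Fin M → Fin d, (List.ofFn fun i => B i (s i)).prod.trace * star (state A M s) := by
  simp only [mixedTransfer, list_prod_ofFn_sum, map_sum, list_prod_ofFn_sandwich,
    trace_sandwich, state]

theorem globalOp_mulVec_state (U : ℤ → Unitary d) (A : Tensor d χ) (M : ℕ) (s : Fin M → Fin d) :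
    (globalOp U M *ᵥ state A M) s =
      (List.ofFn fun i : Fin M => act (U ((i : ℤ) + 1)) A (s i)).prod.trace := by
  simp only [act, list_prod_ofFn_sum, list_prod_ofFn_smul, Matrix.trace_sum, Matrix.trace_smul,
    smul_eq_mul, Matrix.mulVec, dotProduct, globalOp, Matrix.of_apply, state]

theorem trace_prod_mixedTransfer_of_eq_smul {M : ℕ} {U : ℤ → Unitary d} {A : Tensor d χ} {z : ℂ}
    (h : globalOp U M *ᵥ state A M = z • state A M) :
    LinearMap.trace ℂ _
        (List.ofFn fun i : Fin M => mixedTransfer (act (U ((i : ℤ) + 1)) A) A).prod =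
      z * LinearMap.trace ℂ _ (transfer A ^ M) := by
  have hpow : transfer A ^ M = (List.ofFn fun _ : Fin M => mixedTransfer A A).prod := by
    rw [List.ofFn_const, List.prod_replicate, mixedTransfer_self]
  simp only [hpow, trace_prod_mixedTransfer, ← globalOp_mulVec_state, h, Pi.smul_apply, smul_eq_mul,
    mul_assoc, ← Finset.mul_sum]
  rfl

end MixedTransfer

section CyclicContraction

variable {𝕜 E : Type*} [RCLike 𝕜] [NormedAddCommGroup E] [InnerProductSpace 𝕜 E]
  {ι J : Type*} [Fintype ι]

theorem sum_norm_sub_smul_sq {a b : ι → E} {μ : 𝕜}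
    (h : ∑ s, inner 𝕜 (b s) (a s) = μ * ∑ s, (‖b s‖ : 𝕜) ^ 2) :
    ∑ s, ‖a s - μ • b s‖ ^ 2 = ∑ s, ‖a s‖ ^ 2 - ‖μ‖ ^ 2 * ∑ s, ‖b s‖ ^ 2 := by
  have hcross : ∑ s, RCLike.re (inner 𝕜 (a s) (μ • b s)) = ‖μ‖ ^ 2 * ∑ s, ‖b s‖ ^ 2 := by
    simp only [← inner_re_symm (μ • b _), inner_smul_left, ← map_sum, ← Finset.mul_sum, h]
    rw [← mul_assoc, RCLike.conj_mul]
    simp only [← RCLike.ofReal_pow, ← RCLike.ofReal_sum, ← RCLike.ofReal_mul]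
    exact RCLike.ofReal_re _
  simp only [norm_sub_sq (𝕜 := 𝕜), Finset.sum_add_distrib, Finset.sum_sub_distrib, ← Finset.mul_sum,
    hcross, norm_smul, mul_pow]
  ring

theorem eq_smul_of_cyclic_contraction [Finite J] (σ : Equiv.Perm J) {y : J → E} (hy : y ≠ 0)
    {a b : J → ι → E} {μ : 𝕜} (hμ : 1 ≤ ‖μ‖) (ha : ∀ j, ∑ s, ‖a j s‖ ^ 2 = ‖y j‖ ^ 2)
    (hb : ∀ j, ∑ s, ‖b j s‖ ^ 2 = ‖y (σ j)‖ ^ 2)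
    (hab : ∀ j, ∑ s, inner 𝕜 (b j s) (a j s) = μ * (‖y (σ j)‖ : 𝕜) ^ 2) :
    ‖μ‖ = 1 ∧ ∀ j s, a j s = μ • b j s := by
  have := Fintype.ofFinite J
  have hdefect : ∑ j, ∑ s, ‖a j s - μ • b j s‖ ^ 2 = (1 - ‖μ‖ ^ 2) * ∑ j, ‖y j‖ ^ 2 := by
    have hj : ∀ j, ∑ s, ‖a j s - μ • b j s‖ ^ 2 = ‖y j‖ ^ 2 - ‖μ‖ ^ 2 * ‖y (σ j)‖ ^ 2 := fun j => by
      rw [sum_norm_sub_smul_sq (by rw [hab]; congr 1; exact_mod_cast (hb j).symm), ha, hb]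
    simp only [hj, Finset.sum_sub_distrib, ← Finset.mul_sum]
    rw [Equiv.sum_comp σ fun j => ‖y j‖ ^ 2]
    ring
  have hpos : 0 < ∑ j, ‖y j‖ ^ 2 := by
    obtain ⟨j, hj⟩ := Function.ne_iff.1 hy
    exact Finset.sum_pos' (fun _ _ => sq_nonneg _)
      ⟨j, Finset.mem_univ j, pow_pos (norm_pos_iff.2 hj) 2⟩
  have hnonneg : 0 ≤ ∑ j, ∑ s, ‖a j s - μ • b j s‖ ^ 2 := by positivity
  have hμ1 : ‖μ‖ = 1 := by
    have : 0 ≤ 1 - ‖μ‖ ^ 2 := nonneg_of_mul_nonneg_left (hdefect ▸ hnonneg) hpos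
    nlinarith
  refine ⟨hμ1, fun j s => ?_⟩
  rw [hμ1, one_pow, sub_self, zero_mul, Finset.sum_eq_zero_iff_of_nonneg fun _ _ => by positivity]
    at hdefect
  have hs := (Finset.sum_eq_zero_iff_of_nonneg fun _ _ => by positivity).1
    (hdefect j (Finset.mem_univ j)) s (Finset.mem_univ s)
  exact sub_eq_zero.1 (norm_eq_zero.1 (pow_eq_zero_iff two_ne_zero |>.1 hs))

end CyclicContraction

section Intertwiners

variable {d χ L : ℕ}

theorem sum_act_conjTranspose_mul_act (U : Unitary d) (A : Tensor d χ) :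
    ∑ s, (act U A s)ᴴ * act U A s = ∑ s, (A s)ᴴ * A s := by
  have hU : ∀ t t', ∑ s, star (U.1 s t) * U.1 s t' = (1 : Matrix (Fin d) (Fin d) ℂ) t t' := by
    intro t t'
    rw [← Unitary.star_mul_self_of_mem U.2, Matrix.mul_apply]
    rfl
  calc ∑ s, (act U A s)ᴴ * act U A s
      = ∑ s, ∑ t, ∑ t', (star (U.1 s t) * U.1 s t') • ((A t)ᴴ * A t') := by
        simp only [act, Matrix.conjTranspose_sum, Matrix.conjTranspose_smul, Finset.sum_mul_sum,
          smul_mul_smul_comm]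
    _ = ∑ t, ∑ t', (∑ s, star (U.1 s t) * U.1 s t') • ((A t)ᴴ * A t') := by
        rw [Finset.sum_comm]
        simp only [Finset.sum_smul]
        exact Finset.sum_congr rfl fun t _ => Finset.sum_comm
    _ = ∑ t, (A t)ᴴ * A t := by
        simp only [hU, Matrix.one_apply, ite_smul, one_smul, zero_smul, Finset.sum_ite_eq,
          Finset.mem_univ, if_true]

theorem IsLeftCanonical.act {A : Tensor d χ} (hA : IsLeftCanonical A) (U : Unitary d) :
    IsLeftCanonical (act U A) :=
  (sum_act_conjTranspose_mul_act U A).trans hA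

theorem IsLeftCanonical.trace_transfer {B : Tensor d χ} (hB : IsLeftCanonical B)
    (X : Matrix (Fin χ) (Fin χ) ℂ) : (transfer B X).trace = X.trace := by
  simpa [hB.transferLeft_one] using trace_mul_transfer B 1 X

theorem intertwiner_of_mixedTransfer_eq [NeZero L] {A : Tensor d χ} {B : ZMod L → Tensor d χ}
    {ρ : Matrix (Fin χ) (Fin χ) ℂ} (hρ : ρ.PosDef) (hA : transfer A ρ = ρ)
    (hB : ∀ j, IsLeftCanonical (B j)) {y : ZMod L → Matrix (Fin χ) (Fin χ) ℂ} (hy : y ≠ 0) {μ : ℂ}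
    (hμ : 1 ≤ ‖μ‖) (h : ∀ j, mixedTransfer (B j) A (y j * ρ) = μ • (y (j - 1) * ρ)) :
    ‖μ‖ = 1 ∧ ∀ j s, B j s * y j = μ • (y (j - 1) * A s) := by
  let := Matrix.toMatrixNormedAddCommGroup ρ hρ
  let := Matrix.toMatrixInnerProductSpace ρ hρ.posSemidef
  have hinner : ∀ W Z : Matrix (Fin χ) (Fin χ) ℂ, inner ℂ W Z = (Z * ρ * Wᴴ).trace := fun _ _ => rfl
  have hnorm : ∀ W : Matrix (Fin χ) (Fin χ) ℂ, (‖W‖ : ℂ) ^ 2 = (W * ρ * Wᴴ).trace := fun W =>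
    (inner_self_eq_norm_sq_to_K W).symm
  refine eq_smul_of_cyclic_contraction (Equiv.subRight 1) hy hμ
    (a := fun j s => B j s * y j) (b := fun j s => y (j - 1) * A s) (fun j => ?_) (fun j => ?_)
    fun j => ?_
  · rw [← Complex.ofReal_inj]
    push_cast
    rw [hnorm, ← (hB j).trace_transfer, transfer_apply, Matrix.trace_sum]
    simp only [hnorm, Matrix.conjTranspose_mul, Matrix.mul_assoc]
  · rw [← Complex.ofReal_inj]
    push_cast
    rw [Equiv.subRight_apply, hnorm]
    conv_rhs => rw [← hA, transfer_apply, Matrix.mul_sum, Matrix.sum_mul, Matrix.trace_sum]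
    simp only [hnorm, Matrix.conjTranspose_mul, Matrix.mul_assoc]
  · rw [Equiv.subRight_apply, RCLike.ofReal_eq_complex_ofReal, hnorm, ← smul_eq_mul,
      ← Matrix.trace_smul, ← Matrix.smul_mul, ← h,
      mixedTransfer_apply, Matrix.sum_mul, Matrix.trace_sum]
    simp only [hinner, Matrix.conjTranspose_mul, Matrix.mul_assoc]

theorem IsLeftCanonical.transferLeft_gram_of_intertwiner {A B : Tensor d χ}
    (hB : IsLeftCanonical B) {y y' : Matrix (Fin χ) (Fin χ) ℂ} {μ : ℂ} (hμ : ‖μ‖ = 1)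
    (h : ∀ s, B s * y = μ • (y' * A s)) : transferLeft A (y'ᴴ * y') = yᴴ * y := by
  have hs : ∀ s, (A s)ᴴ * (y'ᴴ * y') * A s = yᴴ * ((B s)ᴴ * B s) * y := fun s =>
    calc (A s)ᴴ * (y'ᴴ * y') * A s = (μ • (y' * A s))ᴴ * (μ • (y' * A s)) := by
          rw [Matrix.conjTranspose_smul, smul_mul_smul_comm, RCLike.star_def, RCLike.conj_mul, hμ]
          simp only [Matrix.conjTranspose_mul, Matrix.mul_assoc, RCLike.ofReal_one, one_pow,
            one_smul]
      _ = yᴴ * ((B s)ᴴ * B s) * y := by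
          simp only [← h, Matrix.conjTranspose_mul, Matrix.mul_assoc]
  unfold IsLeftCanonical at hB
  simp only [transferLeft_apply, hs, ← Matrix.mul_sum, ← Matrix.sum_mul, hB, Matrix.mul_one]

theorem IsLeftCanonical.exists_gram_eq_smul_one [NeZero L] {A : Tensor d χ}
    (hL : IsLeftCanonical A) (hA : IsInjective A) {Q : ZMod L → Matrix (Fin χ) (Fin χ) ℂ}
    (hQ : ∀ j, transferLeft A (Q (j - 1)) = Q j) : ∃ c : ℂ, ∀ j, Q j = c • 1 := by
  have hpow : ∀ m : ℕ, (transferLeft A ^ m) (Q 0) = Q m := fun m => by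
    induction m with
    | zero => simp
    | succ m ih =>
      rw [pow_succ', Module.End.mul_apply, ih, Nat.cast_succ, ← hQ (m + 1), add_sub_cancel_right]
  obtain ⟨c, hc⟩ := hL.eq_smul_one_of_transferLeft_pow_eq hA (NeZero.ne L) (by simpa using hpow L)
  refine ⟨c, fun j => ?_⟩
  obtain ⟨m, rfl⟩ := ZMod.natCast_zmod_surjective j
  rw [← hpow, hc, map_smul]
  congr 1
  induction m with
  | zero => rfl
  | succ m ih => rw [pow_succ, Module.End.mul_apply, hL.transferLeft_one, ih]

theorem exists_sq_eq_of_conjTranspose_mul_self [NeZero χ] {Y : Matrix (Fin χ) (Fin χ) ℂ} {c : ℂ}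
    (hY : Y ≠ 0) (h : Yᴴ * Y = c • 1) : ∃ t : ℝ, t ≠ 0 ∧ c = (t : ℂ) ^ 2 := by
  have hc : 0 < c := by
    refine lt_of_le_of_ne ?_ ?_
    · simpa [h] using (Matrix.posSemidef_conjTranspose_mul_self Y).diag_nonneg (i := 0)
    · rintro rfl
      exact hY (Matrix.conjTranspose_mul_self_eq_zero.1 (by rw [h, zero_smul]))
  obtain ⟨r, hr, rfl⟩ := RCLike.pos_iff_exists_ofReal.1 hc
  exact ⟨√r, (Real.sqrt_pos.2 hr).ne', by rw [← Complex.ofReal_pow, Real.sq_sqrt hr.le]; rfl⟩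

theorem exists_unitary_of_conjTranspose_mul_self_eq_smul [NeZero χ] {J : Type*}
    {y : J → Matrix (Fin χ) (Fin χ) ℂ} (hy : y ≠ 0) {c : ℂ} (h : ∀ j, (y j)ᴴ * y j = c • 1) :
    ∃ (t : ℂ) (w : J → Unitary χ), t ≠ 0 ∧ ∀ j, y j = t • (w j : Matrix (Fin χ) (Fin χ) ℂ) := by
  obtain ⟨j, hj⟩ := Function.ne_iff.1 hy
  obtain ⟨t, ht, rfl⟩ := exists_sq_eq_of_conjTranspose_mul_self hj (h j)
  have ht' : (t : ℂ) ≠ 0 := mod_cast ht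
  refine ⟨t, fun j => ⟨(t : ℂ)⁻¹ • y j, ?_⟩, ht', fun j => (smul_inv_smul₀ ht' _).symm⟩
  rw [Matrix.mem_unitaryGroup_iff', Matrix.star_eq_conjTranspose, Matrix.conjTranspose_smul,
    smul_mul_smul_comm, h, smul_smul, star_inv₀, RCLike.star_def, Complex.conj_ofReal, ← mul_inv,
    ← sq, inv_mul_cancel₀ (pow_ne_zero 2 ht'), one_smul]

theorem exists_pushesThrough_of_intertwiner [NeZero L] {A : Tensor d χ} (hL : IsLeftCanonical A)
    (hA : IsInjective A) {U : ZMod L → Unitary d} {y : ZMod L → Matrix (Fin χ) (Fin χ) ℂ}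
    (hy : y ≠ 0) {μ : ℂ} (hμ : ‖μ‖ = 1)
    (h : ∀ j s, act (U j) A s * y j = μ • (y (j - 1) * A s)) :
    ∃ v : ZMod L → Unitary χ, PushesThrough A (fun j : ℤ => U j) fun j : ℤ => v j := by
  have := hA.neZero
  obtain ⟨c, hc⟩ := hL.exists_gram_eq_smul_one hA (Q := fun j => (y j)ᴴ * y j) fun j =>
    (hL.act (U j)).transferLeft_gram_of_intertwiner hμ (h j)
  obtain ⟨t, w, ht, hw⟩ := exists_unitary_of_conjTranspose_mul_self_eq_smul hy hc
  refine ⟨fun j => (w j)⁻¹, fun j => ⟨μ, hμ, funext fun s => ?_⟩⟩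
  have hs := h j s
  rw [hw, hw, mul_smul_comm, smul_mul_assoc, smul_comm μ] at hs
  have hs' := smul_right_injective _ ht hs
  calc act (U j) A s = act (U j) A s * (w j).1 * ((w j).1)ᴴ := by
        rw [Matrix.mul_assoc, ← Matrix.star_eq_conjTranspose, Unitary.mul_star_self_of_mem (w j).2,
          Matrix.mul_one]
    _ = _ := by
        rw [hs']
        simp [Matrix.star_eq_conjTranspose]

end Intertwiners

section Existence

theorem exists_zmod_of_periodic {α : Type*} {L : ℕ} {f : ℤ → α} (hf : Function.Periodic f L) :
    ∃ g : ZMod L → α, ∀ j : ℤ, g j = f j :=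
  ⟨fun j => f j.cast, fun j => by
    change f (j : ZMod L).cast = f j
    rw [ZMod.coe_intCast, Int.emod_def, mul_comm, ← smul_eq_mul, hf.sub_zsmul_eq]⟩

variable {d χ L : ℕ} [NeZero L] {U : ℤ → Unitary d} {A : Tensor d χ}

open scoped Matrix.Norms.L2Operator in
theorem IsSymmetric.not_tendsto_trace (h : IsSymmetric L U A) (hL : IsLeftCanonical A)
    (hA : IsInjective A) :
    ¬ Tendsto (fun k => LinearMap.trace ℂ _
      (List.ofFn fun i : Fin (k * L) => mixedTransfer (act (U ((i : ℤ) + 1)) A) A).prod)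
      atTop (𝓝 0) := by
  obtain ⟨ρ, ℓ, -, hdom⟩ := hL.exists_isDominantPair hA
  intro h0
  have h1 := (hdom.tendsto_trace_pow.comp (tendsto_id.atTop_mul_const' (NeZero.pos L))).norm
  have hnorm : (fun k => ‖LinearMap.trace ℂ _ (List.ofFn fun i : Fin (k * L) =>
      mixedTransfer (act (U ((i : ℤ) + 1)) A) A).prod‖) =ᶠ[atTop]
      fun k => ‖LinearMap.trace ℂ _ (transfer A ^ (k * L))‖ := by
    filter_upwards [eventually_gt_atTop 0] with k hk
    obtain ⟨z, hz, hstate⟩ := h k hk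
    rw [trace_prod_mixedTransfer_of_eq_smul hstate, norm_mul, hz, one_mul]
  exact absurd (tendsto_nhds_unique (h0.norm.congr' hnorm) h1) (by simp)

open scoped Matrix.Norms.L2Operator in
theorem IsSymmetric.exists_pushesThrough (h : IsSymmetric L U A) (hU : Function.Periodic U L)
    (hL : IsLeftCanonical A) (hA : IsInjective A) :
    ∃ v : ℤ → Unitary χ, PushesThrough A U v ∧ Function.Periodic v L := by
  obtain ⟨u, hu⟩ := exists_zmod_of_periodic hU
  obtain rfl : (fun j : ℤ => u j) = U := funext hu
  obtain ⟨ρ, ℓ, hρ, hdom⟩ := hL.exists_isDominantPair hA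
  have hnot := h.not_tendsto_trace hL hA
  simp only [Int.cast_add, Int.cast_natCast, Int.cast_one] at hnot
  obtain ⟨μ, x, hμ, hx, hxE⟩ :=
    exists_twisted_eigenvector (E := fun j => mixedTransfer (act (u j) A) A) hnot
  have hxρ : ∀ j, x j * ρ⁻¹ * ρ = x j := fun j =>
    Matrix.nonsing_inv_mul_cancel_right _ _ ((Matrix.isUnit_iff_isUnit_det ρ).1 hρ.isUnit)
  have hy : (fun j => x j * ρ⁻¹) ≠ 0 := fun h0 => hx <| funext fun j => by
    rw [← hxρ, congrFun h0 j, Pi.zero_apply, Matrix.zero_mul]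
  obtain ⟨hμ1, hint⟩ := intertwiner_of_mixedTransfer_eq hρ hdom.map_vector
    (fun j => hL.act (u j)) hy hμ (by simpa only [hxρ] using hxE)
  obtain ⟨v, hv⟩ := exists_pushesThrough_of_intertwiner hL hA hy hμ1 hint
  exact ⟨fun j => v j, hv, fun j => by simp⟩

omit [NeZero L] in
theorem PushesThrough.const (hA : IsInjective A) {V : Unitary d} {v : ℤ → Unitary χ}
    (h : PushesThrough A (fun _ => V) v) : PushesThrough A (fun _ => V) fun _ => v 0 := by
  obtain ⟨a, ha⟩ := pushesThrough_iff.1 h 1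
  obtain ⟨w, hw⟩ := eqPhase_coe_iff.1 (h.eqPhase hA (h.shift 1) 1)
  have hV : act V A = (a * w) • bondAct (v 0) (v 0) A := by
    have := bondAct_scalarUnitary_mul 1 w (v 0) (v 0) A
    rw [map_one, one_mul, inv_one, one_mul] at this
    rw [← smul_smul, ← this, ha, hw]
    rfl
  exact pushesThrough_iff.2 fun _ => ⟨_, hV⟩

theorem IsSymmetric.exists_pushesThrough_const (h : IsSymmetric L U A)
    (hU : ∀ j, U j = U (j - 1)) (hL : IsLeftCanonical A) (hA : IsInjective A) :
    ∃ v : Unitary χ, PushesThrough A U fun _ => v := by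
  have hper : Function.Periodic U 1 := fun j => by rw [hU, add_sub_cancel_right]
  obtain ⟨V, rfl⟩ : ∃ V, U = fun _ => V := ⟨U 0, funext fun j => by simpa using hper.int_mul_eq j⟩
  obtain ⟨v, hv, -⟩ := h.exists_pushesThrough (fun _ => rfl) hL hA
  exact ⟨v 0, hv.const hA⟩

end Existence

section Gauge

variable {d χ : ℕ} {g : ℂ} {S : (Matrix (Fin χ) (Fin χ) ℂ)ˣ} {A : Tensor d χ}

/-- The tensor `g S A S⁻¹`: a gauge transformation on the bonds together with a rescaling, which
changes the states of `A` by nonzero factors only. -/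
noncomputable def gauge (g : ℂ) (S : (Matrix (Fin χ) (Fin χ) ℂ)ˣ) (A : Tensor d χ) : Tensor d χ :=
  fun s => g • (S.1 * A s * S⁻¹.1)

theorem conjTranspose_gauge (s : Fin d) :
    (gauge g S A s)ᴴ = gauge (star g) (star S⁻¹) (fun s => (A s)ᴴ) s := by
  simp only [gauge, Matrix.conjTranspose_smul, Matrix.conjTranspose_mul, star_inv, inv_inv,
    Units.coe_star, Units.coe_star_inv, Matrix.star_eq_conjTranspose, Matrix.mul_assoc]

theorem list_prod_ofFn_conj {R : Type*} [Semiring R] (S : Rˣ) {M : ℕ} (f : Fin M → R) :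
    (List.ofFn fun i => S.1 * f i * S⁻¹.1).prod = S.1 * (List.ofFn f).prod * S⁻¹.1 := by
  have := List.smul_prod' (r := ConjAct.toConjAct S) (l := List.ofFn f)
  simpa only [List.map_ofFn, ConjAct.units_smul_def, ConjAct.ofConjAct_toConjAct,
    Function.comp_def] using this.symm

theorem state_gauge (M : ℕ) : state (gauge g S A) M = g ^ M • state A M := by
  funext s
  simp only [state, gauge, list_prod_ofFn_smul, list_prod_ofFn_conj, Pi.smul_apply,
    Finset.prod_const, Finset.card_univ, Fintype.card_fin, Matrix.trace_smul]
  rw [Matrix.trace_mul_comm, Units.inv_mul_cancel_left]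

theorem IsSymmetric.gauge {L : ℕ} {U : ℤ → Unitary d} (h : IsSymmetric L U A) :
    IsSymmetric L U (gauge g S A) := fun k hk => by
  obtain ⟨z, hz, hstate⟩ := h k hk
  exact ⟨z, hz, by rw [state_gauge, Matrix.mulVec_smul, hstate, smul_comm]⟩

/-- The congruence `X ↦ S X S†` by an invertible matrix, which carries the transfer matrix of a
tensor to that of its `gauge`. -/
noncomputable def congruence (S : (Matrix (Fin χ) (Fin χ) ℂ)ˣ) :
    Matrix (Fin χ) (Fin χ) ℂ ≃ₗ[ℂ] Matrix (Fin χ) (Fin χ) ℂ where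
  toFun X := S.1 * X * (star S).1
  invFun Y := S⁻¹.1 * Y * (star S)⁻¹.1
  map_add' X Y := by rw [mul_add, add_mul]
  map_smul' c X := by rw [mul_smul_comm, smul_mul_assoc, RingHom.id_apply]
  left_inv X := by simp only [mul_assoc, Units.inv_mul_cancel_left, Units.mul_inv, mul_one]
  right_inv X := by simp only [mul_assoc, Units.mul_inv_cancel_left, Units.inv_mul, mul_one]

theorem congruence_apply (X : Matrix (Fin χ) (Fin χ) ℂ) :
    congruence S X = S.1 * X * S.1ᴴ := rfl

theorem posDef_congruence {X : Matrix (Fin χ) (Fin χ) ℂ} (hX : X.PosDef) :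
    (congruence S X).PosDef :=
  hX.mul_mul_conjTranspose_same (Matrix.vecMul_injective_of_isUnit S.isUnit)

theorem transfer_gauge (X : Matrix (Fin χ) (Fin χ) ℂ) :
    transfer (gauge g S A) (congruence S X) = (‖g‖ : ℂ) ^ 2 • congruence S (transfer A X) := by
  have hS : ∀ Y, S.1ᴴ * ((S⁻¹.1)ᴴ * Y) = Y := (star S).mul_inv_cancel_left
  simp only [transfer_apply, map_sum, Finset.smul_sum, congruence_apply]
  refine Finset.sum_congr rfl fun s _ => ?_
  simp only [gauge, Matrix.conjTranspose_smul, Matrix.conjTranspose_mul, smul_mul_assoc,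
    mul_smul_comm, smul_smul, RCLike.star_def, Complex.conj_mul', Matrix.mul_assoc,
    Units.inv_mul_cancel_left, hS]

theorem hasEigenvector_transfer_gauge_iff (hg : g ≠ 0) {μ : ℂ} {X : Matrix (Fin χ) (Fin χ) ℂ} :
    (transfer (gauge g S A)).HasEigenvector ((‖g‖ : ℂ) ^ 2 * μ) (congruence S X) ↔
      (transfer A).HasEigenvector μ X := by
  have hg2 : (‖g‖ : ℂ) ^ 2 ≠ 0 := by simpa using hg
  rw [Module.End.hasEigenvector_iff, Module.End.hasEigenvector_iff, Module.End.mem_eigenspace_iff,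
    Module.End.mem_eigenspace_iff, transfer_gauge, mul_smul, smul_right_inj hg2, ← map_smul,
    (congruence S).injective.eq_iff, ne_eq, LinearEquiv.map_eq_zero_iff]

theorem hasEigenvector_transferLeft_gauge_iff (hg : g ≠ 0) {μ : ℂ}
    {X : Matrix (Fin χ) (Fin χ) ℂ} :
    (transferLeft (gauge g S A)).HasEigenvector ((‖g‖ : ℂ) ^ 2 * μ) (congruence (star S⁻¹) X) ↔
      (transferLeft A).HasEigenvector μ X := by
  have h := hasEigenvector_transfer_gauge_iff (S := star S⁻¹) (A := fun s => (A s)ᴴ) (μ := μ)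
    (X := X) (star_ne_zero.2 hg)
  rw [norm_star] at h
  simpa only [transferLeft, conjTranspose_gauge] using! h

theorem IsInjective.gauge (hA : IsInjective A) (hg : g ≠ 0) : IsInjective (gauge g S A) := by
  obtain ⟨r, ρ, Λ, hr, hρ, hΛ, eρ, eΛ, gap⟩ := hA
  refine ⟨‖g‖ ^ 2 * r, congruence S ρ, congruence (star S⁻¹) Λ, by positivity,
    posDef_congruence hρ, posDef_congruence hΛ, ?_, ?_, fun μ Y hY hμ => ?_⟩
  · exact_mod_cast (hasEigenvector_transfer_gauge_iff hg).2 eρ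
  · exact_mod_cast (hasEigenvector_transferLeft_gauge_iff hg).2 eΛ
  · obtain ⟨X, rfl⟩ := (congruence S).surjective Y
    obtain ⟨ν, rfl⟩ : ∃ ν, μ = (‖g‖ : ℂ) ^ 2 * ν := ⟨μ / (‖g‖ : ℂ) ^ 2, by field_simp⟩
    have hν : r ≤ ‖ν‖ := by simpa [hg] using hμ
    obtain ⟨rfl, c, rfl⟩ := gap ν X ((hasEigenvector_transfer_gauge_iff hg).1 hY) hν
    exact ⟨by push_cast; rfl, c, map_smul _ _ _⟩

theorem IsInjective.exists_isLeftCanonical_gauge (hA : IsInjective A) :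
    ∃ (g : ℂ) (S : (Matrix (Fin χ) (Fin χ) ℂ)ˣ),
      g ≠ 0 ∧ IsLeftCanonical (DipoleLSM.gauge g S A) := by
  obtain ⟨r, -, Λ, hr, -, hΛ, -, eΛ, -⟩ := hA
  obtain ⟨_, ⟨S, rfl⟩, rfl⟩ := exists_eq_conjTranspose_mul_self hΛ
  have hg : (((√r)⁻¹ : ℝ) : ℂ) ≠ 0 := mod_cast (inv_pos.2 (Real.sqrt_pos.2 hr)).ne'
  have hr1 : (‖(((√r)⁻¹ : ℝ) : ℂ)‖ : ℂ) ^ 2 * r = 1 := by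
    rw [Complex.norm_real, Real.norm_eq_abs]
    norm_cast
    rw [sq_abs, inv_pow, Real.sq_sqrt hr.le, inv_mul_cancel₀ hr.ne']
  have hΛ1 : congruence (star S⁻¹) (S.1ᴴ * S.1) = 1 := by
    have : star S⁻¹ * (star S * S) * star (star S⁻¹) = 1 := by
      rw [star_star, star_inv, inv_mul_cancel_left, mul_inv_cancel]
    exact congrArg Units.val this
  have he := ((hasEigenvector_transferLeft_gauge_iff (S := S) hg).2 eΛ).apply_eq_smul
  rw [hr1, hΛ1, one_smul] at he
  exact ⟨_, S, hg, isLeftCanonical_iff.2 he⟩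

end Gauge

section LSM

variable {d L : ℕ} [NeZero L] {Uq Ud : ℤ → Unitary d}

theorem not_hasSymmetricInjectiveMPS_of_ne_one {ω : Circle} (hω : ω ≠ 1)
    (hq : ∀ j, Uq j = Uq (j - 1)) (hd : ∀ j, Ud j = Ud (j - 1) * Uq (j - 1))
    (hper : Function.Periodic Ud L) (hcomm : ∀ j, Uq j * Ud j = scalarUnitary d ω * (Ud j * Uq j)) :
    ¬ HasSymmetricInjectiveMPS L Uq Ud := by
  rintro ⟨χ, A, hA, hAq, hAd⟩
  have := hA.neZero
  obtain ⟨g, S, hg, hL⟩ := hA.exists_isLeftCanonical_gauge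
  have hA' := hA.gauge (S := S) hg
  obtain ⟨vq, hvq⟩ := hAq.gauge.exists_pushesThrough_const hq hL hA'
  obtain ⟨vd, hvd, -⟩ := hAd.gauge.exists_pushesThrough hper hL hA'
  obtain ⟨c, hc, hstep⟩ := hvq.exists_bondInvariant_eq hA' hcomm hvd
  have hsite := bondInvariant_eq_of_eqPhase_mul (hvq.eqPhase_mul_of_translate hA' hd hvd 0)
  rw [hc, hc, scalarUnitary_injective.eq_iff, hstep, mul_eq_right] at hsite
  exact hω hsite

end LSM

section ClockShift

open scoped commutatorElement

variable (N : ℕ) [NeZero N]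

theorem coe_clock :
    (clock N : Matrix (Fin N) (Fin N) ℂ) =
      Matrix.diagonal fun s : Fin N => (ZMod.toCircle ((s : ℕ) : ZMod N) : ℂ) := by
  simp only [clock, rootPhase_eq_toCircle, Int.cast_natCast]

theorem shift_apply (s t : Fin N) :
    (shift N : Matrix (Fin N) (Fin N) ℂ) s t = if s = t + 1 then 1 else 0 := rfl

theorem clock_mul_shift :
    clock N * shift N = scalarUnitary N (ZMod.toCircle (1 : ZMod N)) * (shift N * clock N) := by
  have hsucc : ∀ t : Fin N, (((t + 1 : Fin N) : ℕ) : ZMod N) = 1 + (t : ℕ) := fun t => by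
    rw [Fin.val_add, ZMod.natCast_mod, Nat.cast_add, Fin.val_one', ZMod.natCast_mod, Nat.cast_one,
      add_comm]
  refine Subtype.ext (Matrix.ext fun s t => ?_)
  rw [coe_scalarUnitary_mul, Circle.smul_def]
  simp only [Submonoid.coe_mul, coe_clock, Matrix.diagonal_mul, Matrix.smul_apply,
    Matrix.mul_diagonal, shift_apply]
  by_cases h : s = t + 1
  · simp [h, hsucc, AddChar.map_add_eq_mul]
  · simp [h]

theorem shift_pow_apply (k : ℕ) (s t : Fin N) :
    ((shift N : Matrix (Fin N) (Fin N) ℂ) ^ k) s t = if s = t + k • 1 then 1 else 0 := by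
  induction k generalizing t with
  | zero => simp [Matrix.one_apply]
  | succ k ih =>
    rw [pow_succ, Matrix.mul_apply]
    simp [ih, shift_apply, succ_nsmul', add_assoc]

theorem shift_pow_self : shift N ^ N = 1 := by
  refine Subtype.ext (Matrix.ext fun s t => ?_)
  have hN : N • (1 : Fin N) = 0 := by simpa using card_nsmul_eq_zero' (x := (1 : Fin N))
  rw [SubmonoidClass.coe_pow, shift_pow_apply, hN, add_zero]
  rfl

theorem clock_pow_self : clock N ^ N = 1 := by
  refine Subtype.ext ?_
  have hphase : (fun s : Fin N => (ZMod.toCircle ((s : ℕ) : ZMod N) : ℂ)) ^ N = 1 := by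
    ext s
    simp [← Circle.coe_pow, ← AddChar.map_nsmul_eq_pow]
  rw [SubmonoidClass.coe_pow, coe_clock, Matrix.diagonal_pow, hphase]
  exact Matrix.diagonal_one

theorem shift_mul_clock_zpow_mul_shift_zpow (n j : ℤ) :
    shift N * (clock N ^ (-n) * shift N ^ j) =
      scalarUnitary N (ZMod.toCircle (n : ZMod N)) * (clock N ^ (-n) * shift N ^ j * shift N) := by
  set ω := scalarUnitary N (ZMod.toCircle (n : ZMod N)) with hω
  have hpow : scalarUnitary N (ZMod.toCircle (1 : ZMod N)) ^ n = ω := by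
    rw [hω, ← map_zpow, ← AddChar.map_zsmul_eq_zpow, zsmul_one]
  have hswap : clock N ^ (-n) * shift N = ω⁻¹ * (shift N * clock N ^ (-n)) := by
    simpa only [zpow_one, mul_one, zpow_neg _ n, hpow] using
      zpow_mul_zpow_eq (scalarUnitary_commute _) (clock_mul_shift N) (-n) 1
  rw [mul_assoc (clock N ^ (-n)), ← (Commute.self_zpow (shift N) j).eq,
    ← mul_assoc (clock N ^ (-n)), hswap, mul_assoc, mul_inv_cancel_left, mul_assoc]

theorem onSiteProjective_clock_shift (n : ℤ) :
    OnSiteProjective N n (fun _ => shift N) (fun j => clock N ^ (-n) * shift N ^ j) :=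
  onSiteProjective_iff.2 fun j => shift_mul_clock_zpow_mul_shift_zpow N n j

theorem isDipoleSymmetry_clock_shift {L : ℕ} (n : ℤ) (hNL : N ∣ L) :
    IsDipoleSymmetry N L (fun _ => shift N) (fun j => clock N ^ (-n) * shift N ^ j) where
  periodic_q _ := rfl
  periodic_d j := by
    obtain ⟨m, rfl⟩ := hNL
    have hL : shift N ^ ((N * m : ℕ) : ℤ) = 1 := by
      rw [zpow_natCast, pow_mul, shift_pow_self, one_pow]
    simp only [zpow_add, hL, mul_one]
  zn_q := isZN_iff.2 fun _ => by
    rw [shift_pow_self]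
    exact one_mem _
  zn_d := isZN_iff.2 fun j => by
    refine mul_pow_mem_of_commutatorElement_mem ?_ ?_ ?_
    · have h := zpow_mul_zpow_eq (scalarUnitary_commute _) (clock_mul_shift N) (-n) j
      rw [commutatorElement_def, h, mul_assoc, mul_assoc, mul_assoc, mul_inv_cancel_left,
        mul_inv_cancel, mul_one, ← map_zpow]
      exact ⟨_, rfl⟩
    · rw [← zpow_natCast, zpow_comm, zpow_natCast, clock_pow_self, one_zpow]
      exact one_mem _
    · rw [← zpow_natCast, zpow_comm, zpow_natCast, shift_pow_self, one_zpow]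
      exact one_mem _
  translate_q _ := rfl
  translate_d j := by rw [mul_assoc, ← zpow_add_one, sub_add_cancel]

end ClockShift

end DipoleLSM

theorem mainTheorem8_general (N L : ℕ) [NeZero N] [NeZero L] (n : ℤ) :
    (∀ (d χ : ℕ) (Uq Ud : ℤ → DipoleLSM.Unitary d) (A : DipoleLSM.Tensor d χ),
      (∀ j, Uq j = Uq (j - 1)) → Function.Periodic Ud (L : ℤ) →
      DipoleLSM.IsInjective A → DipoleLSM.IsLeftCanonical A →
      DipoleLSM.IsSymmetric L Uq A → DipoleLSM.IsSymmetric L Ud A →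
      ∃ (vq : DipoleLSM.Unitary χ) (vd : ℤ → DipoleLSM.Unitary χ),
        DipoleLSM.PushesThrough A Uq (fun _ => vq) ∧ DipoleLSM.PushesThrough A Ud vd ∧
        Function.Periodic vd (L : ℤ)) ∧
    (∀ (d χ : ℕ) (Uq Ud : ℤ → DipoleLSM.Unitary d) (A : DipoleLSM.Tensor d χ)
      (vq : DipoleLSM.Unitary χ) (vd : ℤ → DipoleLSM.Unitary χ),
      (∀ j, Ud j = Ud (j - 1) * Uq (j - 1)) → DipoleLSM.IsInjective A →
      DipoleLSM.PushesThrough A Uq (fun _ => vq) → DipoleLSM.PushesThrough A Ud vd →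
      (∀ j : ℤ, DipoleLSM.EqPhase (vd j : Matrix (Fin χ) (Fin χ) ℂ)
        ((vd (j - 1) : Matrix (Fin χ) (Fin χ) ℂ) * (vq : Matrix (Fin χ) (Fin χ) ℂ))) ∧
      ∀ j : ℤ, DipoleLSM.bondInvariant vq (vd j) = DipoleLSM.bondInvariant vq (vd (j - 1))) ∧
    (∀ (d χ : ℕ) (Uq Ud : ℤ → DipoleLSM.Unitary d) (A : DipoleLSM.Tensor d χ)
      (vq : DipoleLSM.Unitary χ) (vd : ℤ → DipoleLSM.Unitary χ),
      DipoleLSM.IsZN N Uq → DipoleLSM.OnSiteProjective N n Uq Ud → DipoleLSM.IsInjective A →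
      DipoleLSM.PushesThrough A Uq (fun _ => vq) → DipoleLSM.PushesThrough A Ud vd →
      ∃ k : ℤ → ℤ,
        (∀ j : ℤ, (DipoleLSM.bondInvariant vq (vd j) : Matrix (Fin χ) (Fin χ) ℂ) =
          DipoleLSM.rootPhase N (k j) • 1) ∧
        ∀ j : ℤ, k j ≡ k (j - 1) + n [ZMOD N]) ∧
    (∀ (d : ℕ) (Uq Ud : ℤ → DipoleLSM.Unitary d) (ω : Circle), ω ≠ 1 →
      (∀ j, Uq j = Uq (j - 1)) → (∀ j, Ud j = Ud (j - 1) * Uq (j - 1)) →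
      Function.Periodic Ud (L : ℤ) →
      (∀ j, Uq j * Ud j = DipoleLSM.scalarUnitary d ω * (Ud j * Uq j)) →
      ¬ DipoleLSM.HasSymmetricInjectiveMPS L Uq Ud) := by
  refine ⟨fun d χ Uq Ud A hq hd hA hL hAq hAd => ?_,
    fun d χ Uq Ud A vq vd hU hA hq hd => ?_,
    fun d χ Uq Ud A vq vd hZN hU hA hq hd => hq.exists_bondInvariant_eq_rootPhase hA hZN hU hd,
    fun d Uq Ud ω hω hq hd hper hcomm =>
      DipoleLSM.not_hasSymmetricInjectiveMPS_of_ne_one hω hq hd hper hcomm⟩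
  · obtain ⟨vq, hvq⟩ := hAq.exists_pushesThrough_const hq hL hA
    obtain ⟨vd, hvd, hper⟩ := hAd.exists_pushesThrough hd hL hA
    exact ⟨vq, vd, hvq, hvd, hper⟩
  · have hv := hq.eqPhase_mul_of_translate hA hU hd
    exact ⟨hv, fun j => DipoleLSM.bondInvariant_eq_of_eqPhase_mul (hv j)⟩

theorem mainTheorem8 (N L : ℕ) [NeZero N] [NeZero L] (n : ℤ) :
    -- a symmetric injective MPS has unitary push-through data, with a site-independent `v_q`
    (∀ (d χ : ℕ) (Uq Ud : ℤ → DipoleLSM.Unitary d) (A : DipoleLSM.Tensor d χ),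
      DipoleLSM.IsDipoleSymmetry N L Uq Ud →
      DipoleLSM.IsInjective A → DipoleLSM.IsLeftCanonical A →
      DipoleLSM.IsSymmetric L Uq A → DipoleLSM.IsSymmetric L Ud A →
      ∃ (vq : DipoleLSM.Unitary χ) (vd : ℤ → DipoleLSM.Unitary χ),
        DipoleLSM.PushesThrough A Uq (fun _ => vq) ∧ DipoleLSM.PushesThrough A Ud vd ∧
        ∀ j : ℤ, DipoleLSM.EqPhase (vd (j + L) : Matrix (Fin χ) (Fin χ) ℂ)
          (vd j : Matrix (Fin χ) (Fin χ) ℂ)) ∧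
    -- the dipole algebra forces the bond invariant to be site-independent
    (∀ (d χ : ℕ) (Uq Ud : ℤ → DipoleLSM.Unitary d) (A : DipoleLSM.Tensor d χ)
      (vq : DipoleLSM.Unitary χ) (vd : ℤ → DipoleLSM.Unitary χ),
      DipoleLSM.IsDipoleSymmetry N L Uq Ud → DipoleLSM.IsInjective A →
      DipoleLSM.PushesThrough A Uq (fun _ => vq) → DipoleLSM.PushesThrough A Ud vd →
      (∀ j : ℤ, DipoleLSM.EqPhase (vd j : Matrix (Fin χ) (Fin χ) ℂ)
        ((vd (j - 1) : Matrix (Fin χ) (Fin χ) ℂ) * (vq : Matrix (Fin χ) (Fin χ) ℂ))) ∧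
      ∀ j : ℤ, DipoleLSM.bondInvariant vq (vd j) = DipoleLSM.bondInvariant vq (vd (j - 1))) ∧
    -- the on-site projective relation makes the bond invariant an `N`-th root of unity that
    -- changes by `exp (2 π i n / N)` from each bond to the next
    (∀ (d χ : ℕ) (Uq Ud : ℤ → DipoleLSM.Unitary d) (A : DipoleLSM.Tensor d χ)
      (vq : DipoleLSM.Unitary χ) (vd : ℤ → DipoleLSM.Unitary χ),
      DipoleLSM.IsZN N Uq → DipoleLSM.IsZN N Ud → DipoleLSM.OnSiteProjective N n Uq Ud →
      DipoleLSM.IsInjective A →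
      DipoleLSM.PushesThrough A Uq (fun _ => vq) → DipoleLSM.PushesThrough A Ud vd →
      ∃ k : ℤ → ℤ,
        (∀ j : ℤ, (DipoleLSM.bondInvariant vq (vd j) : Matrix (Fin χ) (Fin χ) ℂ) =
          DipoleLSM.rootPhase N (k j) • 1) ∧
        ∀ j : ℤ, k j ≡ k (j - 1) + n [ZMOD N]) ∧
    -- the LSM constraint
    (∀ (d : ℕ) (Uq Ud : ℤ → DipoleLSM.Unitary d),
      DipoleLSM.IsDipoleSymmetry N L Uq Ud → DipoleLSM.OnSiteProjective N n Uq Ud →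
      ¬ (N : ℤ) ∣ n → ¬ DipoleLSM.HasSymmetricInjectiveMPS L Uq Ud) ∧
    -- the qudit chain with `U_q = ⨂ X_j` and `U_d = ⨂ Z_j^{-n} X_j^j`
    (N ∣ L →
      DipoleLSM.IsDipoleSymmetry N L (fun _ => DipoleLSM.shift N)
        (fun j => DipoleLSM.clock N ^ (-n) * DipoleLSM.shift N ^ j) ∧
      DipoleLSM.OnSiteProjective N n (fun _ => DipoleLSM.shift N)
        (fun j => DipoleLSM.clock N ^ (-n) * DipoleLSM.shift N ^ j) ∧
      (¬ (N : ℤ) ∣ n →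
        ¬ DipoleLSM.HasSymmetricInjectiveMPS L (fun _ => DipoleLSM.shift N)
          (fun j => DipoleLSM.clock N ^ (-n) * DipoleLSM.shift N ^ j))) := by
  obtain ⟨push, site, change, lsm⟩ := mainTheorem8_general N L n
  have lsm_N {d : ℕ} {Uq Ud : ℤ → DipoleLSM.Unitary d} (h : DipoleLSM.IsDipoleSymmetry N L Uq Ud)
      (hU : DipoleLSM.OnSiteProjective N n Uq Ud) (hn : ¬ (N : ℤ) ∣ n) :
      ¬ DipoleLSM.HasSymmetricInjectiveMPS L Uq Ud :=
    lsm d Uq Ud _ ((DipoleLSM.toCircle_intCast_eq_one_iff N n).not.2 hn) h.translate_q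
      h.translate_d h.periodic_d (DipoleLSM.onSiteProjective_iff.1 hU)
  refine ⟨fun d χ Uq Ud A h hA hL hAq hAd => ?_,
    fun d χ Uq Ud A vq vd h => site d χ Uq Ud A vq vd h.translate_d,
    fun d χ Uq Ud A vq vd hZN _ => change d χ Uq Ud A vq vd hZN,
    fun d Uq Ud => lsm_N, fun hNL => ?_⟩
  · obtain ⟨vq, vd, hq, hd, hper⟩ := push d χ Uq Ud A h.translate_q h.periodic_d hA hL hAq hAd
    exact ⟨vq, vd, hq, hd, fun j => by rw [hper j]; exact DipoleLSM.EqPhase.refl _⟩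
  · have h := DipoleLSM.isDipoleSymmetry_clock_shift N n hNL
    have hU := DipoleLSM.onSiteProjective_clock_shift N n
    exact ⟨h, hU, lsm_N h hU⟩
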